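/- Let $A$ be a unital $C^*$-algebra, let $E\subseteq A$ be an operator space, i.e. a norm-closed linear subspace of $A$, let $K$ be a complex Hilbert space and let $u:E\to B(K)$ be a linear map. For $n\ge 1$ let $M_n(E)\subseteq M_n(A)$ be the space of $n\times n$ matrices with entries in $E$, with the norm and the positive elements inherited from the $C^*$-algebra $M_n(A)$, let $u_n:M_n(E)\to M_n(B(K))=B(K^{(n)})$ be the map $u_n([a_{ij}])=[u(a_{ij})]$, and let $\|u\|_{cb}=\sup_{n\ge1}\|u_n\|\in[0,\infty]$. The map $u$ is completely bounded if $\|u\|_{cb}<\infty$. (1) The following conditions are equivalent: (i) $u$ is completely bounded and $\|u\|_{cb}\le 1$; (ii) there are a complex Hilbert space $\hat H$, a unital $*$-representation $\pi:A\to B(\hat H)$ and linear maps $V,W:K\to\hat H$ with $\|V\|\le1$ and $\|W\|\le 1$ such that $u(a)=V^*\pi(a)W$ for all $a\in E$. (2) Suppose moreover that $E$ is an operator system, i.e. $1\in E$, and $x^*\in E$ for every $x\in E$. Call $u$ completely positive if for every $n\ge 1$ the map $u_n$ sends positive elements of $M_n(A)$ lying in $M_n(E)$ to positive elements of $M_n(B(K))$.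 Then (a) $u$ is completely positive if and only if there are a complex Hilbert space $\hat H$, a unital $*$-representation $\pi:A\to B(\hat H)$ and a bounded linear map $V:K\to\hat H$ such that $u(a)=V^*\pi(a)V$ for all $a\in E$; (b) $u$ is completely positive with $\|u\|_{cb}\le1$ if and only if there is such a factorisation with $\|V\|\le 1$. -/

import Mathlib

open scoped ENNReal

universe uA uK w

noncomputable section

/-- A closed linear subspace of a C⋆-algebra `A`, seen as a concrete operator space. -/
def IsOperatorSpace {A : Type*} [CStarAlgebra A] (E : Submodule ℂ A) : Prop :=
  IsClosed (E : Set A)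

/-- A closed linear subspace of a unital C⋆-algebra which contains the unit and is closed
under the involution. -/
structure IsOperatorSystem {A : Type*} [CStarAlgebra A] (S : Submodule ℂ A) : Prop where
  isClosed : IsClosed (S : Set A)
  one_mem : (1 : A) ∈ S
  star_mem : ∀ x ∈ S, star x ∈ S

section

variable {A B : Type*} [CStarAlgebra A] [PartialOrder A] [StarOrderedRing A]
  [CStarAlgebra B] [PartialOrder B] [StarOrderedRing B]

/-- `M_n(E)`: the matrices over the C⋆-algebra `A` whose entries lie in the subspace `E`.
As a subspace of `CStarMatrix (Fin n) (Fin n) A` it carries the norm and the order of the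
C⋆-algebra `M_n(A)`. -/
def matrixSpace (E : Submodule ℂ A) (n : ℕ) :
    Submodule ℂ (CStarMatrix (Fin n) (Fin n) A) where
  carrier := {x | ∀ i j, x i j ∈ E}
  add_mem' hx hy i j := E.add_mem (hx i j) (hy i j)
  zero_mem' _ _ := E.zero_mem
  smul_mem' c _ hx i j := E.smul_mem c (hx i j)

/-- The amplification `u_n : M_n(E) → M_n(B)`, `[a i j] ↦ [u (a i j)]`. -/
def amplification {E : Submodule ℂ A} (u : E →ₗ[ℂ] B) (n : ℕ) :
    matrixSpace E n →ₗ[ℂ] CStarMatrix (Fin n) (Fin n) B where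
  toFun x := CStarMatrix.ofMatrix fun i j => u ⟨x.1 i j, x.2 i j⟩
  map_add' x y := CStarMatrix.ext fun i j =>
    u.map_add ⟨x.1 i j, x.2 i j⟩ ⟨y.1 i j, y.2 i j⟩
  map_smul' c x := CStarMatrix.ext fun i j => u.map_smul c ⟨x.1 i j, x.2 i j⟩

/-- The operator norm `‖u_n‖` of the `n`-th amplification, with value `∞` if `u_n` is
unbounded. -/
def amplificationNorm {E : Submodule ℂ A} (u : E →ₗ[ℂ] B) (n : ℕ) : ℝ≥0∞ :=
  ⨆ (x : matrixSpace E n) (_ : ‖x‖ ≤ 1), ‖amplification u n x‖ₑ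

/-- The completely bounded norm `‖u‖_cb = sup_{n ≥ 1} ‖u_n‖ ∈ [0, ∞]`. -/
def cbNorm {E : Submodule ℂ A} (u : E →ₗ[ℂ] B) : ℝ≥0∞ :=
  ⨆ (n : ℕ) (_ : 1 ≤ n), amplificationNorm u n

/-- `u` is completely bounded: `‖u‖_cb < ∞`. -/
def IsCompletelyBounded {E : Submodule ℂ A} (u : E →ₗ[ℂ] B) : Prop :=
  cbNorm u < ∞

/-- `u` is `n`-positive: `u_n` maps `M_n(S) ∩ M_n(A)₊` into `M_n(B)₊`. -/
def IsNPositive {S : Submodule ℂ A} (u : S →ₗ[ℂ] B) (n : ℕ) : Prop :=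
  ∀ x : matrixSpace S n, 0 ≤ (x : CStarMatrix (Fin n) (Fin n) A) → 0 ≤ amplification u n x

/-- `u` is completely positive: it is `n`-positive for every `n`. -/
def IsCompletelyPositive {S : Submodule ℂ A} (u : S →ₗ[ℂ] B) : Prop :=
  ∀ n : ℕ, IsNPositive u n

end

end

/-! Fix a Hamel basis `b` of `K`, indexed by `I`. A map `u` is encoded by the functional sending the
matrix unit `(i, j)` with entry `a` to `⟪b i, u a (b j)⟫`. If such a functional, given on a space of
finitely supported matrices over `A` containing the diagonal scalar units, is positive on matrices
with positive real part, M. Riesz's theorem extends it to all finitely supported matrices over `A`.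
A GNS construction then produces `π` and vectors `ξ i` with `⟪ξ i, π a (ξ j)⟫` equal to the value at
`(i, j)`, `a`. Extension and dilation thus become one step, `FinsuppMatrix.exists_representation`,
and `V` is the linear map with `V (b i) = ξ i`.

For completely positive `u` the positivity of the functional is complete positivity applied to `x +
x*`. For completely contractive `u` one uses Paulsen's trick: index by `I ⊕ I` and take block
matrices with scalar diagonal blocks and a corner in `E`. Positivity is `re_nonneg_of_gram`:
normalising the scalar blocks turns the corner into a contraction over `E`, to which `‖u‖_cb ≤ 1`
applies. The converses are computations with quadratic forms of operator matrices. -/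

open scoped InnerProductSpace ComplexConjugate

noncomputable section

/-! ### Positive elements and Gram matrices over a C⋆-algebra. -/

section Decomposition

variable {D : Type*} [NonUnitalCStarAlgebra D] [PartialOrder D] [StarOrderedRing D]

lemma exists_eq_star_mul_self_of_nonneg {x : D} (hx : 0 ≤ x) : ∃ r, x = star r * r :=
  CStarAlgebra.nonneg_iff_eq_star_mul_self.mp hx

/-- The decomposition of a self-adjoint element into orthogonal positive parts, with the negative
part written as `star r * r`. -/
lemma IsSelfAdjoint.exists_eq_sub_star_mul_self {y : D} (hy : IsSelfAdjoint y) :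
    ∃ p r : D, 0 ≤ p ∧ y = p - star r * r ∧
      y * (star r * r) = -((star r * r) * (star r * r)) := by
  obtain ⟨r, hr⟩ := exists_eq_star_mul_self_of_nonneg (CFC.negPart_nonneg y)
  refine ⟨y⁺, r, CFC.posPart_nonneg y, ?_, ?_⟩
  · rw [← hr, CFC.posPart_sub_negPart y hy]
  · rw [← hr]
    nth_rewrite 1 [← CFC.posPart_sub_negPart y hy]
    rw [sub_mul, CFC.posPart_mul_negPart, zero_sub]

lemma ofReal_smul_nonneg {c : ℝ} (hc : 0 ≤ c) {x : D} (hx : 0 ≤ x) : 0 ≤ (c : ℂ) • x := by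
  rw [Complex.coe_smul]
  exact smul_nonneg hc hx

end Decomposition

namespace CStarMatrix

section Gram

variable {A : Type*} [CStarAlgebra A] [PartialOrder A] [StarOrderedRing A]
  {ι κ : Type*} [Fintype ι] [Fintype κ]

/-- A Gram matrix `Pᴴ P` over a C⋆-algebra is positive, for `P` rectangular. -/
lemma gram_nonneg (P : κ → ι → A) :
    0 ≤ (ofMatrix (fun i j => ∑ k, star (P k i) * P k j) : CStarMatrix ι ι A) := by
  classical
  have hrow : ∀ v : ι → A, 0 ≤ (ofMatrix (fun i j => star (v i) * v j) : CStarMatrix ι ι A) := by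
    intro v
    rcases isEmpty_or_nonempty ι with hι | ⟨⟨i₀⟩⟩
    · exact le_of_eq (ext fun i => hι.elim i)
    -- The row `v` is padded with zero rows to a square matrix, which leaves its Gram matrix
    -- unchanged.
    · let R : CStarMatrix ι ι A := ofMatrix fun i j => if i = i₀ then v j else 0
      convert star_mul_self_nonneg R using 1
      ext i j
      change star (v i) * v j =
        ∑ k, star (if k = i₀ then v i else 0) * (if k = i₀ then v j else 0)
      simp
  have hsum : (ofMatrix (fun i j => ∑ k, star (P k i) * P k j) : CStarMatrix ι ι A) =
      ∑ k, (ofMatrix (fun i j => star (P k i) * P k j) : CStarMatrix ι ι A) := by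
    ext i j
    have happ : ∀ (s : Finset κ) (f : κ → CStarMatrix ι ι A),
        (∑ k ∈ s, f k) i j = ∑ k ∈ s, f k i j := fun s f => by
      induction s using Finset.induction_on with
      | empty => simp
      | insert a s ha ih => simp [Finset.sum_insert ha, ih]
    rw [happ]
    rfl
  rw [hsum]
  exact Finset.sum_nonneg fun k _ => hrow _

lemma exists_gram {x : CStarMatrix ι ι A} (hx : 0 ≤ x) :
    ∃ r : ι → ι → A, ∀ i j, x i j = ∑ k, star (r k i) * r k j := by
  obtain ⟨r, rfl⟩ := exists_eq_star_mul_self_of_nonneg hx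
  exact ⟨r, fun i j => by simp [mul_apply, star_apply]⟩

variable [DecidableEq ι]

lemma norm_le_one_iff_star_mul_self_le {x : CStarMatrix ι ι A} : ‖x‖ ≤ 1 ↔ star x * x ≤ 1 := by
  rw [← CStarAlgebra.norm_le_one_iff_of_nonneg _ (star_mul_self_nonneg x),
    CStarRing.norm_star_mul_self]
  exact ⟨fun h => mul_le_one₀ h (norm_nonneg _) h,
    fun h => by nlinarith [norm_nonneg x]⟩

/-- The off-diagonal corner `Pᴴ Q` is a contraction if `P` and `Q` are column contractions. -/
lemma norm_gram_le_one {P Q : κ → ι → A}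
    (hP : (ofMatrix (fun i j => ∑ k, star (P k i) * P k j) : CStarMatrix ι ι A) ≤ 1)
    (hQ : (ofMatrix (fun i j => ∑ k, star (Q k i) * Q k j) : CStarMatrix ι ι A) ≤ 1) :
    ‖(ofMatrix (fun i j => ∑ k, star (P k i) * Q k j) : CStarMatrix ι ι A)‖ ≤ 1 := by
  rw [norm_le_one_iff_star_mul_self_le]
  set p : CStarMatrix ι ι A := ofMatrix (fun i j => ∑ k, star (P k i) * P k j) with hp
  set q : CStarMatrix ι ι A := ofMatrix (fun i j => ∑ k, star (Q k i) * Q k j) with hq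
  set c : CStarMatrix ι ι A := ofMatrix (fun i j => ∑ k, star (P k i) * Q k j) with hc
  -- With `c = PᴴQ`, the Gram matrix of `Q - Pc` is `q - 2c*c + c*pc`. Since `p ≤ 1`, its positivity
  -- gives `c*c ≤ q ≤ 1`.
  have hg := gram_nonneg (fun k i => Q k i - ∑ l, P k l * c l i)
  have hexp : (ofMatrix (fun i j => ∑ k, star (Q k i - ∑ l, P k l * c l i) *
      (Q k j - ∑ l, P k l * c l j)) : CStarMatrix ι ι A) =
      q - star c * c - star c * c + star c * p * c := by
    let P' : Matrix κ ι A := Matrix.of P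
    let Q' : Matrix κ ι A := Matrix.of Q
    let C' : Matrix ι ι A := c
    have h1 : (ofMatrix (fun i j => ∑ k, star (Q k i - ∑ l, P k l * c l i) *
      (Q k j - ∑ l, P k l * c l j)) : CStarMatrix ι ι A) =
        ofMatrix ((Q' - P' * C').conjTranspose * (Q' - P' * C')) := rfl
    have h2 : p = ofMatrix (P'.conjTranspose * P') := rfl
    have h3 : q = ofMatrix (Q'.conjTranspose * Q') := rfl
    have h5 : C' = (P'.conjTranspose * Q') := rfl
    have h6 : star c * c = ofMatrix (C'.conjTranspose * C') := rfl
    have h7 : star c * p * c = ofMatrix (C'.conjTranspose * (P'.conjTranspose * P') * C') := rfl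
    have h8 : C'.conjTranspose = Q'.conjTranspose * P' := by
      rw [h5, Matrix.conjTranspose_mul, Matrix.conjTranspose_conjTranspose]
    rw [h1, h6, h7, h3, of_sub_of, of_sub_of, of_add_of]
    congr 1
    rw [Matrix.conjTranspose_sub, Matrix.conjTranspose_mul]
    have h9 : Q'.conjTranspose * (P' * C') = C'.conjTranspose * C' := by
      rw [← Matrix.mul_assoc, h8]
    have h10 : C'.conjTranspose * P'.conjTranspose * Q' = C'.conjTranspose * C' := by
      rw [Matrix.mul_assoc, h5]
    simp only [Matrix.sub_mul, Matrix.mul_sub, h9, h10, Matrix.mul_assoc]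
    abel
  rw [hexp] at hg
  have hc1 : star c * p * c ≤ star c * c := by
    simpa using star_left_conjugate_le_conjugate hP c
  rw [← sub_nonneg]
  calc (0 : CStarMatrix ι ι A) ≤ (1 - q) + (q - star c * c - star c * c + star c * p * c) +
        (star c * c - star c * p * c) :=
        add_nonneg (add_nonneg (sub_nonneg.mpr hQ) hg) (sub_nonneg.mpr hc1)
    _ = 1 - star c * c := by abel

end Gram

/-! ### Quadratic forms of matrices of operators. -/

section Action

variable {H : Type*} [NormedAddCommGroup H] [InnerProductSpace ℂ H] [CompleteSpace H]
  {ι κ : Type*} [Fintype ι] [Fintype κ]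

/-- Both sides are `‖r h‖²` for the operator matrix `r` acting on the column `h`. This converts
factorisations `r* r` into norm identities without identifying the matrix algebra with operators on
a direct sum. -/
lemma sum_inner_gram (r : κ → ι → (H →L[ℂ] H)) (h : ι → H) :
    ∑ i, ∑ j, ⟪h i, (∑ k, star (r k i) * r k j) (h j)⟫_ℂ =
      ((∑ k, ‖∑ j, r k j (h j)‖ ^ 2 : ℝ) : ℂ) := by
  rw [Complex.ofReal_sum]
  have : ∀ k, (((‖∑ j, r k j (h j)‖ ^ 2 : ℝ) : ℂ)) =
      ∑ i, ∑ j, ⟪h i, (star (r k i) * r k j) (h j)⟫_ℂ := fun k => by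
    have hself := inner_self_eq_norm_sq_to_K (𝕜 := ℂ) (∑ j, r k j (h j))
    rw [RCLike.ofReal_eq_complex_ofReal] at hself
    rw [Complex.ofReal_pow, ← hself, sum_inner]
    refine Finset.sum_congr rfl fun i _ => ?_
    rw [inner_sum]
    refine Finset.sum_congr rfl fun j _ => ?_
    exact (ContinuousLinearMap.adjoint_inner_right (r k i) _ _).symm
  simp_rw [this]
  refine Eq.symm ?_
  rw [Finset.sum_comm]
  refine Finset.sum_congr rfl fun i _ => ?_
  rw [Finset.sum_comm]
  refine Finset.sum_congr rfl fun j _ => ?_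
  rw [_root_.sum_apply, inner_sum]

/-- A self-adjoint matrix of operators whose quadratic form is nonnegative is positive. -/
lemma nonneg_of_forall_sum_inner {y : CStarMatrix ι ι (H →L[ℂ] H)} (hy : IsSelfAdjoint y)
    (hpos : ∀ h : ι → H, 0 ≤ (∑ i, ∑ j, ⟪h i, y i j (h j)⟫_ℂ).re) : 0 ≤ y := by
  classical
  -- Let `z = r*r` be the negative part of `y`. The form of `y` at `z h` is that of `zyz =
  -- -(rz)*(rz)`, so nonnegativity forces `rz = 0`, hence `z² = r*(rz) = 0` and `z = 0`.
  obtain ⟨p, r, hp, hypr, hyz'⟩ := hy.exists_eq_sub_star_mul_self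
  obtain ⟨z, hz⟩ : ∃ z, z = star r * r := ⟨_, rfl⟩
  have hzsa : star z = z := by rw [hz, star_mul, star_star]
  have hyz : z * y * z = -(star (r * z) * (r * z)) := by
    rw [mul_assoc, hz, hyz', ← hz, star_mul, hzsa, mul_neg, mul_assoc z (star r), ← mul_assoc _ r,
      ← hz]
  have hact : ∀ h : ι → H, ∀ k, ∑ j, (r * z) k j (h j) = 0 := by
    intro h
    have key : ∑ i, ∑ j, ⟪∑ k, z i k (h k), y i j (∑ k, z j k (h k))⟫_ℂ =
        ∑ i, ∑ j, ⟪h i, (z * y * z) i j (h j)⟫_ℂ := by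
      have hL : ∀ i j, ⟪∑ k, z i k (h k), y i j (∑ k, z j k (h k))⟫_ℂ =
          ∑ k, ∑ l, ⟪h k, (z k i * y i j * z j l) (h l)⟫_ℂ := fun i j => by
        rw [sum_inner]
        refine Finset.sum_congr rfl fun k _ => ?_
        rw [map_sum, inner_sum]
        refine Finset.sum_congr rfl fun l _ => ?_
        have : z k i = star (z i k) := by rw [← star_apply, hzsa]
        rw [this]
        exact (ContinuousLinearMap.adjoint_inner_right (z i k) _ _).symm
      have hR : ∀ k l, ⟪h k, (z * y * z) k l (h l)⟫_ℂ =
          ∑ i, ∑ j, ⟪h k, (z k i * y i j * z j l) (h l)⟫_ℂ := fun k l => by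
        rw [mul_apply]
        simp_rw [mul_apply, Finset.sum_mul]
        rw [Finset.sum_comm]
        simp_rw [_root_.sum_apply, inner_sum]
      simp_rw [hL, hR]
      calc _ = ∑ i, ∑ k, ∑ j, ∑ l, ⟪h k, (z k i * y i j * z j l) (h l)⟫_ℂ := by
            refine Finset.sum_congr rfl fun i _ => Finset.sum_comm
        _ = ∑ k, ∑ i, ∑ j, ∑ l, ⟪h k, (z k i * y i j * z j l) (h l)⟫_ℂ := Finset.sum_comm
        _ = ∑ k, ∑ i, ∑ l, ∑ j, ⟪h k, (z k i * y i j * z j l) (h l)⟫_ℂ := by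
            refine Finset.sum_congr rfl fun k _ => Finset.sum_congr rfl fun i _ =>
              Finset.sum_comm
        _ = _ := Finset.sum_congr rfl fun k _ => Finset.sum_comm
    have h2 := hpos fun i => ∑ k, z i k (h k)
    rw [key, hyz] at h2
    have h3 := sum_inner_gram (fun k i => (r * z) k i) h
    have h4 : ∑ i, ∑ j, ⟪h i, (-(star (r * z) * (r * z))) i j (h j)⟫_ℂ =
        -((∑ k, ‖∑ j, (r * z) k j (h j)‖ ^ 2 : ℝ) : ℂ) := by
      rw [← h3, ← Finset.sum_neg_distrib]
      refine Finset.sum_congr rfl fun i _ => ?_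
      rw [← Finset.sum_neg_distrib]
      refine Finset.sum_congr rfl fun j _ => ?_
      rw [neg_apply, mul_apply (M := star (r * z))]
      simp [star_apply, inner_neg_right, inner_sum]
    rw [h4, Complex.neg_re, Complex.ofReal_re] at h2
    have h5 := (Finset.sum_eq_zero_iff_of_nonneg fun k _ => by positivity).mp
      (le_antisymm (neg_nonneg.mp h2) (Finset.sum_nonneg fun k _ => by positivity))
    exact fun k => by simpa using h5 k (Finset.mem_univ k)
  have hrz : r * z = 0 := by
    ext k j v
    have := hact (Pi.single j v) k
    rw [Finset.sum_eq_single j (fun b _ hb => by simp [hb]) (by simp)] at this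
    simpa using this
  have hzz : star z * z = 0 := by
    rw [hzsa]
    nth_rewrite 1 [hz]
    rw [mul_assoc, hrz, mul_zero]
  have hz1 : z = 0 := CStarRing.star_mul_self_eq_zero_iff z |>.mp hzz
  rwa [hypr, ← hz, hz1, sub_zero]

/-- The row norm estimate that characterises contractions among matrices of operators. -/
lemma norm_le_one_of_forall_sum_norm_sq_le [DecidableEq ι] {d : CStarMatrix ι ι (H →L[ℂ] H)}
    (hd : ∀ h : ι → H, ∑ k, ‖∑ j, d k j (h j)‖ ^ 2 ≤ ∑ j, ‖h j‖ ^ 2) : ‖d‖ ≤ 1 := by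
  rw [norm_le_one_iff_star_mul_self_le, ← sub_nonneg]
  refine nonneg_of_forall_sum_inner ((IsSelfAdjoint.one _).sub (.star_mul_self d)) fun h => ?_
  have h1 := sum_inner_gram (fun k i => d k i) h
  have h2 : ∑ i, ∑ j, ⟪h i, (1 - star d * d) i j (h j)⟫_ℂ =
      ((∑ j, ‖h j‖ ^ 2 - ∑ k, ‖∑ j, d k j (h j)‖ ^ 2 : ℝ) : ℂ) := by
    rw [Complex.ofReal_sub, ← h1]
    simp only [sub_apply, _root_.sub_apply, inner_sub_right, Finset.sum_sub_distrib]
    congr 1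
    push_cast
    refine Finset.sum_congr rfl fun i _ => ?_
    rw [Finset.sum_eq_single i (fun j _ hj => by simp [one_apply_ne' hj]) (by simp)]
    rw [one_apply_eq, one_apply_eq_self, inner_self_eq_norm_sq_to_K,
      RCLike.ofReal_eq_complex_ofReal]
  rw [h2, Complex.ofReal_re, sub_nonneg]
  exact hd h

variable {A : Type*} [CStarAlgebra A] [PartialOrder A] [StarOrderedRing A]

/-- Writing `1 - x*x = r*r` and applying `π` entrywise, the difference of the two sides is
`‖π(r)h‖²`. -/
lemma sum_norm_sq_le_of_norm_le_one (π : A →⋆ₐ[ℂ] (H →L[ℂ] H)) [DecidableEq ι]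
    {x : CStarMatrix ι ι A} (hx : ‖x‖ ≤ 1) (h : ι → H) :
    ∑ k, ‖∑ j, π (x k j) (h j)‖ ^ 2 ≤ ∑ j, ‖h j‖ ^ 2 := by
  rw [norm_le_one_iff_star_mul_self_le, ← sub_nonneg] at hx
  obtain ⟨r, hr⟩ := exists_gram hx
  have h1 := sum_inner_gram (fun k i => π (r k i)) h
  have h2 := sum_inner_gram (fun k i => π (x k i)) h
  have h3 : ((∑ k, ‖∑ j, π (r k j) (h j)‖ ^ 2 : ℝ) : ℂ) =
      ((∑ j, ‖h j‖ ^ 2 - ∑ k, ‖∑ j, π (x k j) (h j)‖ ^ 2 : ℝ) : ℂ) := by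
    rw [← h1, Complex.ofReal_sub, ← h2]
    have h4 : ((∑ j, ‖h j‖ ^ 2 : ℝ) : ℂ) =
        ∑ i, ∑ j, ⟪h i, π ((1 : CStarMatrix ι ι A) i j) (h j)⟫_ℂ := by
      push_cast
      refine Finset.sum_congr rfl fun i _ => ?_
      rw [Finset.sum_eq_single i (fun j _ hj => by simp [one_apply_ne' hj]) (by simp)]
      rw [one_apply_eq, map_one, one_apply_eq_self, inner_self_eq_norm_sq_to_K]
      rfl
    rw [h4, ← Finset.sum_sub_distrib]
    refine Finset.sum_congr rfl fun i _ => ?_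
    rw [← Finset.sum_sub_distrib]
    refine Finset.sum_congr rfl fun j _ => ?_
    rw [← inner_sub_right, ← _root_.sub_apply]
    congr 2
    have := congrArg π (hr i j)
    simp only [map_sum, map_mul, map_star] at this
    rw [← this, sub_apply, map_sub, mul_apply]
    simp [star_apply, map_star]
  have h5 : 0 ≤ ∑ k, ‖∑ j, π (r k j) (h j)‖ ^ 2 := by positivity
  rw [Complex.ofReal_inj.mp h3] at h5
  linarith

lemma sum_inner_nonneg (π : A →⋆ₐ[ℂ] (H →L[ℂ] H)) {x : CStarMatrix ι ι A} (hx : 0 ≤ x)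
    (h : ι → H) : 0 ≤ (∑ i, ∑ j, ⟪h i, π (x i j) (h j)⟫_ℂ).re := by
  obtain ⟨r, hr⟩ := exists_gram hx
  have h1 := sum_inner_gram (fun k i => π (r k i)) h
  simp_rw [hr, map_sum, map_mul, map_star]
  rw [h1, Complex.ofReal_re]
  positivity

end Action

end CStarMatrix

/-! ### Riesz extension and the accretive cone of finitely supported matrices. -/

/-- **M. Riesz extension theorem** for a functional on a parametrised subspace. -/
lemma exists_nonneg_extension {P X : Type*} [AddCommGroup P] [Module ℝ P] [AddCommGroup X]
    [Module ℝ X] (s : PointedCone ℝ X) (T : P →ₗ[ℝ] X) (f : P →ₗ[ℝ] ℝ)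
    (hf : ∀ p, T p ∈ s → 0 ≤ f p) (hdense : ∀ x, ∃ p, T p + x ∈ s) :
    ∃ g : X →ₗ[ℝ] ℝ, (∀ p, g (T p) = f p) ∧ ∀ x ∈ s, 0 ≤ g x := by
  -- `f` descends to the range of `T`: for `p` in the kernel, both `p` and `-p` are sent to `0 ∈ s`.
  have hker : LinearMap.ker T ≤ LinearMap.ker f := fun p hp => by
    rw [LinearMap.mem_ker] at hp ⊢
    have h1 := hf p (by rw [hp]; exact s.zero_mem)
    have h2 := hf (-p) (by rw [map_neg, hp, neg_zero]; exact s.zero_mem)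
    rw [map_neg] at h2
    linarith
  let f₀ : X →ₗ.[ℝ] ℝ :=
    ⟨LinearMap.range T, (LinearMap.ker T).liftQ f hker ∘ₗ T.quotKerEquivRange.symm.toLinearMap⟩
  have hf₀ : ∀ p (hp : T p ∈ f₀.domain), f₀ ⟨T p, hp⟩ = f p := fun p hp => by
    change (LinearMap.ker T).liftQ f hker (T.quotKerEquivRange.symm ⟨T p, hp⟩) = f p
    rw [T.quotKerEquivRange_symm_apply_image p hp]
    simp
  obtain ⟨g, hg, hgs⟩ := riesz_extension s f₀
    (by
      rintro ⟨_, p, rfl⟩ hx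
      exact (hf p hx).trans_eq (hf₀ p ⟨p, rfl⟩).symm)
    (fun x => by
      obtain ⟨p, hp⟩ := hdense x
      exact ⟨⟨T p, p, rfl⟩, hp⟩)
  exact ⟨g, fun p => (hg ⟨T p, p, rfl⟩).trans (hf₀ p _), hgs⟩

namespace FinsuppMatrix

variable {I : Type*} {A : Type*} [CStarAlgebra A]

/-- The finitely supported matrix `[star (x i) * y j]`. -/
def outer (x y : I →₀ A) : I × I →₀ A :=
  Finsupp.onFinset (x.support ×ˢ y.support) (fun p => star (x p.1) * y p.2) fun p hp => by
    rw [Finset.mem_product, Finsupp.mem_support_iff, Finsupp.mem_support_iff]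
    constructor <;> intro h <;> simp [h] at hp

@[simp]
lemma outer_apply (x y : I →₀ A) (p : I × I) : outer x y p = star (x p.1) * y p.2 := rfl

lemma outer_add_left (x y z : I →₀ A) : outer (x + y) z = outer x z + outer y z := by
  ext p
  simp [add_mul]

lemma outer_add_right (x y z : I →₀ A) : outer x (y + z) = outer x y + outer x z := by
  ext p
  simp [mul_add]

lemma outer_smul_left (c : ℂ) (x y : I →₀ A) : outer (c • x) y = conj c • outer x y := by
  ext p
  simp

lemma outer_single (i j : I) (a b : A) :
    outer (Finsupp.single i a) (Finsupp.single j b) = Finsupp.single (i, j) (star a * b) := by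
  classical
  ext ⟨k, l⟩
  simp only [outer_apply, Finsupp.single_apply, Prod.mk.injEq]
  split_ifs <;> simp_all

variable [PartialOrder A] [StarOrderedRing A]

variable (I A) in
/-- The finitely supported matrices whose real part is positive. -/
def accretiveCone : PointedCone ℝ (I × I →₀ A) where
  -- Only the real part is tested, so self-adjointness is not required of `x` and the cone contains
  -- all skew-Hermitian matrices.
  carrier := {x | ∀ (ι : Type) [Fintype ι] (e : ι → I),
    0 ≤ (CStarMatrix.ofMatrix (fun i j => x (e i, e j) + star (x (e j, e i))) :
      CStarMatrix ι ι A)}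
  add_mem' {x y} hx hy ι _ e := by
    convert add_nonneg (hx ι e) (hy ι e) using 1
    refine CStarMatrix.ext fun i j => ?_
    change x (e i, e j) + y (e i, e j) + star (x (e j, e i) + y (e j, e i)) =
      x (e i, e j) + star (x (e j, e i)) + (y (e i, e j) + star (y (e j, e i)))
    rw [star_add]
    abel
  zero_mem' ι _ e := by
    refine le_of_eq (CStarMatrix.ext fun i j => ?_)
    change (0 : A) = 0 + star 0
    simp
  smul_mem' c x hx ι _ e := by
    convert ofReal_smul_nonneg c.2 (hx ι e) using 1
    refine CStarMatrix.ext fun i j => ?_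
    change (c : ℝ) • x (e i, e j) + star ((c : ℝ) • x (e j, e i)) =
      ((c : ℝ) : ℂ) • (x (e i, e j) + star (x (e j, e i)))
    rw [Complex.coe_smul, smul_add, star_smul, star_trivial]

lemma outer_self_mem (v : I →₀ A) : outer v v ∈ accretiveCone I A := fun ι _ e => by
  have h := CStarMatrix.gram_nonneg (A := A) (fun (_ : Unit) i => v (e i))
  convert add_nonneg h h using 1
  refine CStarMatrix.ext fun i j => ?_
  change star (v (e i)) * v (e j) + star (star (v (e j)) * v (e i)) =
    ∑ _k : Unit, star (v (e i)) * v (e j) + ∑ _k : Unit, star (v (e i)) * v (e j)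
  simp

/-- The hypothesis is stable under negation, so a functional nonnegative on the cone vanishes on
such `x`. This is the source of hermitian symmetry. -/
lemma mem_of_add_star_eq_zero {x : I × I →₀ A} (hx : ∀ i j, x (i, j) + star (x (j, i)) = 0) :
    x ∈ accretiveCone I A := fun ι _ e => by
  exact le_of_eq (CStarMatrix.ext fun i j => (hx _ _).symm)

lemma ofReal_smul_mem {c : ℝ} (hc : 0 ≤ c) {x : I × I →₀ A} (hx : x ∈ accretiveCone I A) :
    (c : ℂ) • x ∈ accretiveCone I A := by
  rw [Complex.coe_smul]
  exact (accretiveCone I A).smul_mem hc hx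

/-- The element `d` completes `a` to a column with scalar Gram element. This gives the domination of
matrix units, the boundedness of left multiplication, and the compatibility of completely positive
maps with the involution. -/
lemma exists_star_mul_self_add (a : A) :
    ∃ d : A, star a * a + star d * d = ((‖a‖ ^ 2 : ℝ) : ℂ) • 1 := by
  obtain ⟨d, hd⟩ := exists_eq_star_mul_self_of_nonneg
    (sub_nonneg.mpr (CStarAlgebra.star_mul_le_algebraMap_norm_sq (a := a)))
  refine ⟨d, ?_⟩
  rw [← hd, add_sub_cancel, Complex.coe_smul, Algebra.algebraMap_eq_smul_one]

/-- Matrix units multiplied by algebra elements are dominated by diagonal scalars. -/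
lemma exists_add_single_mem (i j : I) (a : A) : ∃ c d : ℂ,
    c • Finsupp.single (i, i) 1 + d • Finsupp.single (j, j) 1 + Finsupp.single (i, j) a ∈
      accretiveCone I A := by
  classical
  obtain ⟨d, hd⟩ := exists_star_mul_self_add a
  -- With `v = e_i + a e_j` and `w = d e_j`, half of `outer v v + outer w w` is `(E_ii + a E_ij + a*
  -- E_ji + ‖a‖² E_jj)/2`. Adding the skew matrix `(a E_ij - a* E_ji)/2` gives the claimed element.
  refine ⟨2⁻¹, 2⁻¹ * (‖a‖ ^ 2 : ℝ), ?_⟩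
  have hv := outer_self_mem (Finsupp.single i 1 + Finsupp.single j a)
  have hw := outer_self_mem (Finsupp.single j d)
  have hs : (2⁻¹ : ℂ) • (Finsupp.single (i, j) a - Finsupp.single (j, i) (star a)) ∈
      accretiveCone I A := by
    refine mem_of_add_star_eq_zero fun k l => ?_
    simp only [Finsupp.smul_apply, Finsupp.sub_apply, Finsupp.single_apply, Prod.mk.injEq,
      star_smul]
    by_cases h1 : i = k <;> by_cases h2 : j = l <;> by_cases h3 : i = l <;> by_cases h4 : j = k <;>
      simp [h1, h2, h3, h4, ← smul_add] <;> simp_all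
  have hhalf : (0 : ℝ) ≤ 2⁻¹ := by norm_num
  convert add_mem hs (ofReal_smul_mem hhalf (add_mem hv hw)) using 1
  have hd' : ((‖a‖ ^ 2 : ℝ) : ℂ) • Finsupp.single (j, j) (1 : A) =
      Finsupp.single (j, j) (star a * a) + Finsupp.single (j, j) (star d * d) := by
    rw [← Finsupp.single_add, hd, Finsupp.smul_single]
  rw [outer_add_left, outer_add_right, outer_add_right, mul_smul, hd']
  simp only [outer_single, star_one, one_mul, mul_one]
  push_cast
  module

end FinsuppMatrix

/-! ### The GNS construction for a positive form. -/

open FinsuppMatrix in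
/-- A functional on finitely supported `I × I` matrices over `A` which is hermitian and positive
on the matrices `[star (x i) * x j]`. -/
structure PositiveForm (I : Type*) (A : Type*) [CStarAlgebra A] where
  toFun : (I × I →₀ A) →ₗ[ℂ] ℂ
  conj_outer : ∀ x y : I →₀ A, conj (toFun (outer x y)) = toFun (outer y x)
  re_nonneg : ∀ x : I →₀ A, 0 ≤ (toFun (outer x x)).re

namespace PositiveForm

open FinsuppMatrix

variable {I : Type*} {A : Type*} [CStarAlgebra A] (φ : PositiveForm I A)

/-- The finitely supported `A`-valued functions, with the semi-inner product given by `φ`. -/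
@[nolint unusedArguments]
def PreGNS (_φ : PositiveForm I A) := I →₀ A

instance : AddCommGroup φ.PreGNS := inferInstanceAs (AddCommGroup (I →₀ A))
instance : Module ℂ φ.PreGNS := inferInstanceAs (Module ℂ (I →₀ A))

/-- The identity map, as a linear equivalence onto the type synonym. -/
def toPreGNS : (I →₀ A) ≃ₗ[ℂ] φ.PreGNS := LinearEquiv.refl ℂ _

/-- The semi-inner product given by a positive form. -/
abbrev preInnerProductCore : PreInnerProductSpace.Core ℂ φ.PreGNS where
  inner x y := φ.toFun (outer (φ.toPreGNS.symm x) (φ.toPreGNS.symm y))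
  conj_inner_symm x y := φ.conj_outer _ _
  re_inner_nonneg x := φ.re_nonneg _
  add_left x y z := by rw [map_add, outer_add_left, map_add]
  smul_left x y c := by rw [map_smul, outer_smul_left, map_smul, smul_eq_mul]

instance : SeminormedAddCommGroup φ.PreGNS :=
  InnerProductSpace.Core.toSeminormedAddCommGroup (c := φ.preInnerProductCore)
instance : InnerProductSpace ℂ φ.PreGNS :=
  InnerProductSpace.ofCore φ.preInnerProductCore

lemma inner_def (x y : I →₀ A) :
    ⟪φ.toPreGNS x, φ.toPreGNS y⟫_ℂ = φ.toFun (outer x y) := rfl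

lemma norm_sq (x : I →₀ A) : ‖φ.toPreGNS x‖ ^ 2 = (φ.toFun (outer x x)).re := by
  rw [← inner_def, ← inner_self_eq_norm_sq (𝕜 := ℂ)]
  rfl

/-- The Hilbert space of a positive form. -/
abbrev GNS := UniformSpace.Completion φ.PreGNS

/-- Entrywise left multiplication, as a linear map on finitely supported functions. -/
def leftMulₗ (I : Type*) {A : Type*} [CStarAlgebra A] (a : A) : (I →₀ A) →ₗ[ℂ] (I →₀ A) :=
  Finsupp.mapRange.linearMap (LinearMap.mulLeft ℂ a)

@[simp]
lemma leftMulₗ_apply (a : A) (x : I →₀ A) (i : I) : leftMulₗ I a x i = a * x i := rfl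

lemma outer_leftMul_left (a : A) (x y : I →₀ A) :
    outer (leftMulₗ I a x) y = outer x (leftMulₗ I (star a) y) := by
  ext p
  simp [mul_assoc]

variable [PartialOrder A] [StarOrderedRing A]

/-- The defect is the value of `φ` at the outer square of `d x`, where `d*d = ‖a‖² - a*a`. -/
lemma re_outer_leftMul_le (a : A) (x : I →₀ A) :
    (φ.toFun (outer (leftMulₗ I a x) (leftMulₗ I a x))).re ≤
      ‖a‖ ^ 2 * (φ.toFun (outer x x)).re := by
  obtain ⟨d, hd⟩ := exists_star_mul_self_add a
  have h : outer (leftMulₗ I a x) (leftMulₗ I a x) + outer (leftMulₗ I d x) (leftMulₗ I d x) =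
      ((‖a‖ ^ 2 : ℝ) : ℂ) • outer x x := by
    ext p
    have := congrArg (fun t => star (x p.1) * t * x p.2) hd
    simpa [mul_assoc, mul_add, add_mul] using this
  have h2 := congrArg (fun t => (φ.toFun t).re) h
  simp only [map_add, map_smul, Complex.add_re, smul_eq_mul, Complex.re_ofReal_mul] at h2
  linarith [φ.re_nonneg (leftMulₗ I d x)]

/-- Left multiplication on the pre-Hilbert space of a positive form. -/
def leftMul (a : A) : φ.PreGNS →L[ℂ] φ.PreGNS :=
  LinearMap.mkContinuous
    (φ.toPreGNS.toLinearMap ∘ₗ leftMulₗ I a ∘ₗ φ.toPreGNS.symm.toLinearMap) ‖a‖ fun x => by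
      obtain ⟨x, rfl⟩ := φ.toPreGNS.surjective x
      rw [← sq_le_sq₀ (norm_nonneg _) (by positivity), mul_pow, norm_sq]
      exact (φ.norm_sq _).trans_le (φ.re_outer_leftMul_le a x)

lemma leftMul_toPreGNS (a : A) (x : I →₀ A) :
    φ.leftMul a (φ.toPreGNS x) = φ.toPreGNS (leftMulₗ I a x) := rfl

open UniformSpace Completion in
/-- The representation of `A` on the Hilbert space of a positive form. -/
def gnsRep : A →⋆ₐ[ℂ] (φ.GNS →L[ℂ] φ.GNS) where
  toFun a := (φ.leftMul a).completion
  map_one' := by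
    ext c
    induction c using induction_on with
    | hp => apply isClosed_eq <;> fun_prop
    | ih c =>
      obtain ⟨x, rfl⟩ := φ.toPreGNS.surjective c
      have : leftMulₗ I (1 : A) x = x := by ext i; simp
      simp [leftMul_toPreGNS, this]
  map_mul' a b := by
    ext c
    induction c using induction_on with
    | hp => apply isClosed_eq <;> fun_prop
    | ih c =>
      obtain ⟨x, rfl⟩ := φ.toPreGNS.surjective c
      have : leftMulₗ I (a * b) x = leftMulₗ I a (leftMulₗ I b x) := by ext i; simp [mul_assoc]
      simp [leftMul_toPreGNS, this]
  map_zero' := by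
    ext c
    induction c using induction_on with
    | hp => apply isClosed_eq <;> fun_prop
    | ih c =>
      obtain ⟨x, rfl⟩ := φ.toPreGNS.surjective c
      have : leftMulₗ I (0 : A) x = 0 := by ext i; simp
      simp [leftMul_toPreGNS, this, Completion.coe_zero]
  map_add' a b := by
    ext c
    induction c using induction_on with
    | hp => apply isClosed_eq <;> fun_prop
    | ih c =>
      obtain ⟨x, rfl⟩ := φ.toPreGNS.surjective c
      have : leftMulₗ I (a + b) x = leftMulₗ I a x + leftMulₗ I b x := by ext i; simp [add_mul]
      simp [leftMul_toPreGNS, this, Completion.coe_add]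
  commutes' r := by
    ext c
    induction c using induction_on with
    | hp => apply isClosed_eq <;> fun_prop
    | ih c =>
      obtain ⟨x, rfl⟩ := φ.toPreGNS.surjective c
      have : leftMulₗ I (r • (1 : A)) x = r • x := by ext i; simp
      simp [leftMul_toPreGNS, this, Algebra.algebraMap_eq_smul_one, Completion.coe_smul]
  map_star' a := by
    refine (ContinuousLinearMap.eq_adjoint_iff _ _).mpr fun x y => ?_
    induction x, y using induction_on₂ with
    | hp => apply isClosed_eq <;> fun_prop
    | ih x y =>
      obtain ⟨x, rfl⟩ := φ.toPreGNS.surjective x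
      obtain ⟨y, rfl⟩ := φ.toPreGNS.surjective y
      simp [leftMul_toPreGNS, inner_def, outer_leftMul_left]

/-- The vector of the index `i` in the Hilbert space of a positive form. -/
def gnsVector (i : I) : φ.GNS := (φ.toPreGNS (Finsupp.single i 1) : φ.PreGNS)

lemma inner_gnsRep (i j : I) (a : A) :
    ⟪φ.gnsVector i, φ.gnsRep a (φ.gnsVector j)⟫_ℂ = φ.toFun (Finsupp.single (i, j) a) := by
  have h : leftMulₗ I a (Finsupp.single j 1) = Finsupp.single j a := by
    classical
    ext k
    simp [Finsupp.single_apply]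
  have h2 : φ.gnsRep a (φ.gnsVector j) = (φ.toPreGNS (Finsupp.single j a) : φ.PreGNS) := by
    change (φ.leftMul a).completion _ = _
    rw [gnsVector, ContinuousLinearMap.completion_apply_coe, leftMul_toPreGNS, h]
  rw [h2, gnsVector, UniformSpace.Completion.inner_coe, inner_def, outer_single, star_one, one_mul]

end PositiveForm

/-! ### Simultaneous extension and dilation. -/

namespace FinsuppMatrix

/-- Simultaneous extension and dilation: a functional on a space of matrices which contains the
diagonal scalars and on which the functional is positive is given by a representation. -/
theorem exists_representation {I : Type uK} {A : Type uA} [CStarAlgebra A] [PartialOrder A]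
    [StarOrderedRing A] {P : Type*} [AddCommGroup P] [Module ℂ P]
    (T : P →ₗ[ℂ] (I × I →₀ A)) (F : P →ₗ[ℂ] ℂ)
    (hF : ∀ p, T p ∈ accretiveCone I A → 0 ≤ (F p).re)
    (hdiag : ∀ i, ∃ p, T p = Finsupp.single (i, i) 1) :
    ∃ (H : Type (max uK uA)) (_ : NormedAddCommGroup H) (_ : InnerProductSpace ℂ H)
      (_ : CompleteSpace H) (π : A →⋆ₐ[ℂ] (H →L[ℂ] H)) (ξ : I → H),
      ∀ p i j a, T p = Finsupp.single (i, j) a → ⟪ξ i, π a (ξ j)⟫_ℂ = F p := by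
  obtain ⟨g, hgT, hg⟩ := exists_nonneg_extension (accretiveCone I A) (T.restrictScalars ℝ)
    (Complex.reLm ∘ₗ F.restrictScalars ℝ) hF (fun x => by
      induction x using Finsupp.induction_linear with
      | zero => exact ⟨0, by simp⟩
      | add x y hx hy =>
        obtain ⟨p, hp⟩ := hx
        obtain ⟨q, hq⟩ := hy
        refine ⟨p + q, ?_⟩
        convert add_mem hp hq using 1
        rw [map_add]
        abel
      | single q a =>
        obtain ⟨i, j⟩ := q
        obtain ⟨p₁, h₁⟩ := hdiag i
        obtain ⟨p₂, h₂⟩ := hdiag j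
        obtain ⟨c, d, hcd⟩ := exists_add_single_mem i j a
        refine ⟨c • p₁ + d • p₂, ?_⟩
        rwa [LinearMap.restrictScalars_apply, map_add, map_smul, map_smul, h₁, h₂])
  have hskew : ∀ x : I × I →₀ A, (∀ i j, x (i, j) + star (x (j, i)) = 0) → g x = 0 := fun x hx => by
    refine le_antisymm ?_ (hg x (mem_of_add_star_eq_zero hx))
    have := hg (-x) (mem_of_add_star_eq_zero fun i j => by
      rw [Finsupp.neg_apply, Finsupp.neg_apply, star_neg, ← neg_add, hx, neg_zero])
    rw [map_neg] at this
    linarith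
  -- `G x = g x - i g (i x)`. It extends `F` because a complex functional is determined by its real
  -- part.
  let G : (I × I →₀ A) →ₗ[ℂ] ℂ := Module.Dual.extendRCLike g
  have hGre : ∀ x, (G x).re = g x := fun x => Module.Dual.re_extendRCLike_apply (𝕜 := ℂ) g x
  have hGim : ∀ x, (G x).im = -g (Complex.I • x) := fun x =>
    Module.Dual.im_extendRCLike_apply (𝕜 := ℂ) g x
  have hGT : ∀ p, G (T p) = F p := fun p => by
    have hg' : ∀ p, g (T p) = (F p).re := hgT
    refine Complex.ext ?_ ?_
    · rw [hGre, hg']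
    · rw [hGim, ← map_smul, hg', map_smul]
      simp
  let φ : PositiveForm I A :=
    { toFun := G
      conj_outer := fun x y => by
        -- The adjoint of `outer x y` is `outer y x`, so these two combinations are skew. They give
        -- the real and imaginary parts of the symmetry.
        have h1 := hskew (outer x y - outer y x) fun i j => by simp
        have h2 := hskew (Complex.I • outer x y + Complex.I • outer y x) fun i j => by simp
        rw [map_sub, sub_eq_zero] at h1
        rw [map_add] at h2
        refine Complex.ext ?_ ?_
        · rw [Complex.conj_re, hGre, hGre, h1]
        · rw [Complex.conj_im, hGim, hGim, neg_neg]
          linarith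
      re_nonneg := fun x => by
        rw [hGre]
        exact hg _ (outer_self_mem x) }
  refine ⟨φ.GNS, inferInstance, inferInstance, inferInstance, φ.gnsRep, φ.gnsVector,
    fun p i j a hp => ?_⟩
  rw [φ.inner_gnsRep, ← hp]
  exact hGT p

end FinsuppMatrix

/-! ### Finite sections, and operators determined by a Hamel basis. -/

section Enumeration

lemma Finset.exists_fin_enum {I : Type*} (s : Finset I) :
    ∃ (n : ℕ) (e : Fin n → I), Function.Injective e ∧ ∀ i ∈ s, i ∈ Set.range e := by
  refine ⟨s.card, fun k => s.equivFin.symm k, fun a b hab => ?_, fun i hi => ?_⟩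
  · exact s.equivFin.symm.injective (Subtype.ext hab)
  · exact ⟨s.equivFin ⟨i, hi⟩, by simp⟩

lemma Finsupp.sum_prod_eq_sum_fin {I M N : Type*} [Zero M] [AddCommMonoid N] (x : I × I →₀ M)
    (β : I × I → M → N) (hβ : ∀ q, β q 0 = 0) {n : ℕ} {e : Fin n → I}
    (he : Function.Injective e)
    (hx : ∀ q ∈ x.support, q.1 ∈ Set.range e ∧ q.2 ∈ Set.range e) :
    x.sum β = ∑ i, ∑ j, β (e i, e j) (x (e i, e j)) := by
  classical
  rw [Finsupp.sum_of_support_subset x (s := Finset.univ.image (Prod.map e e)) ?_ β fun q _ => hβ q]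
  · rw [Finset.sum_image fun p _ q _ h => he.prodMap he h, Fintype.sum_prod_type]
    rfl
  · intro q hq
    obtain ⟨⟨i, hi⟩, ⟨j, hj⟩⟩ := hx q hq
    exact Finset.mem_image.mpr ⟨(i, j), Finset.mem_univ _, Prod.ext hi hj⟩

end Enumeration

section Sesquilinear

variable {K H I : Type*} [NormedAddCommGroup K] [InnerProductSpace ℂ K]
  [NormedAddCommGroup H] [InnerProductSpace ℂ H]

/-- For a Hamel basis this is pure algebra, first linear in `l`, then conjugate-linear in `k`. No
continuity is needed, so it can be used to prove that `V` is bounded. -/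
lemma Module.Basis.inner_eq_inner (b : Module.Basis I ℂ K) (V W : K →ₗ[ℂ] H) (S : H →ₗ[ℂ] H)
    (R : K →ₗ[ℂ] K) (h : ∀ i j, ⟪V (b i), S (W (b j))⟫_ℂ = ⟪b i, R (b j)⟫_ℂ) (k l : K) :
    ⟪V k, S (W l)⟫_ℂ = ⟪k, R l⟫_ℂ := by
  have h1 : ∀ i, ⟪V (b i), S (W l)⟫_ℂ = ⟪b i, R l⟫_ℂ := fun i => by
    have : (innerₛₗ ℂ (V (b i))) ∘ₗ S ∘ₗ W = (innerₛₗ ℂ (b i)) ∘ₗ R :=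
      b.ext fun j => by simpa using h i j
    simpa using LinearMap.congr_fun this l
  have h2 : (innerₛₗ ℂ (S (W l))) ∘ₗ V = innerₛₗ ℂ (R l) := b.ext fun i => by
    have := congrArg conj (h1 i)
    rw [inner_conj_symm, inner_conj_symm] at this
    simpa using this
  have h3 := congrArg conj (LinearMap.congr_fun h2 k)
  simpa using h3

/-- Vectors whose Gram matrix is that of a form bounded by `‖R‖` define a bounded operator. -/
lemma Module.Basis.exists_clm_of_inner (b : Module.Basis I ℂ K) (ξ : I → H) (R : K →L[ℂ] K)
    (h : ∀ i j, ⟪ξ i, ξ j⟫_ℂ = ⟪b i, R (b j)⟫_ℂ) :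
    ∃ V : K →L[ℂ] H, ‖V‖ ≤ √‖R‖ ∧ ∀ i, V (b i) = ξ i := by
  let V₀ : K →ₗ[ℂ] H := b.constr ℂ ξ
  have hV₀ : ∀ i, V₀ (b i) = ξ i := fun i => b.constr_basis ℂ ξ i
  have hin := b.inner_eq_inner V₀ V₀ LinearMap.id R.toLinearMap fun i j => by
    rw [LinearMap.id_apply, hV₀, hV₀]
    exact h i j
  have hbound : ∀ k, ‖V₀ k‖ ≤ √‖R‖ * ‖k‖ := fun k => by
    rw [← sq_le_sq₀ (norm_nonneg _) (by positivity), mul_pow, Real.sq_sqrt (norm_nonneg _),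
      ← inner_self_eq_norm_sq (𝕜 := ℂ)]
    have h1 : ⟪V₀ k, V₀ k⟫_ℂ = ⟪k, R k⟫_ℂ := hin k k
    rw [h1]
    calc RCLike.re ⟪k, R k⟫_ℂ ≤ ‖k‖ * ‖R k‖ := re_inner_le_norm _ _
      _ ≤ ‖k‖ * (‖R‖ * ‖k‖) := by gcongr; exact R.le_opNorm k
      _ = ‖R‖ * ‖k‖ ^ 2 := by ring
  exact ⟨V₀.mkContinuous _ hbound, LinearMap.mkContinuous_norm_le _ (by positivity) _, hV₀⟩

/-- The matrix coefficient `a ↦ ⟪k, u a l⟫`. -/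
def coeffMap {E : Type*} [AddCommGroup E] [Module ℂ E] (u : E →ₗ[ℂ] (K →L[ℂ] K)) (k l : K) :
    E →ₗ[ℂ] ℂ :=
  innerₛₗ ℂ k ∘ₗ (ContinuousLinearMap.apply ℂ K l).toLinearMap ∘ₗ u

@[simp]
lemma coeffMap_apply {E : Type*} [AddCommGroup E] [Module ℂ E] (u : E →ₗ[ℂ] (K →L[ℂ] K)) (k l : K)
    (a : E) : coeffMap u k l a = ⟪k, u a l⟫_ℂ := rfl

variable [CompleteSpace K] [CompleteSpace H]

lemma ContinuousLinearMap.eq_adjoint_comp_of_basis (b : Module.Basis I ℂ K) (V W : K →L[ℂ] H)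
    (S : H →L[ℂ] H) (R : K →L[ℂ] K) (h : ∀ i j, ⟪V (b i), S (W (b j))⟫_ℂ = ⟪b i, R (b j)⟫_ℂ) :
    R = (ContinuousLinearMap.adjoint V).comp (S.comp W) := by
  ext l
  refine ext_inner_left ℂ fun k => ?_
  rw [ContinuousLinearMap.comp_apply, ContinuousLinearMap.adjoint_inner_right]
  exact (b.inner_eq_inner V.toLinearMap W.toLinearMap S.toLinearMap R.toLinearMap h k l).symm

end Sesquilinear

/-! ### Dilation of completely positive maps. -/

section CompletelyPositive

variable {A : Type uA} [CStarAlgebra A] [PartialOrder A] [StarOrderedRing A]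
  {K : Type uK} [NormedAddCommGroup K] [InnerProductSpace ℂ K] [CompleteSpace K]
  {E : Submodule ℂ A} {u : E →ₗ[ℂ] (K →L[ℂ] K)}

/-- The matrix `[[1, a], [a*, ‖a‖²]]` is the Gram matrix of `[[1, a], [0, d]]` and has entries in
`E`. Its image under `u_2` is positive, hence self-adjoint, and the off-diagonal corners are
compared. -/
lemma IsCompletelyPositive.map_star (hu : IsCompletelyPositive u) (hE : IsOperatorSystem E)
    (a : E) : u ⟨star a, hE.star_mem a a.2⟩ = star (u a) := by
  obtain ⟨d, hd⟩ := FinsuppMatrix.exists_star_mul_self_add (a : A)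
  have hpos := CStarMatrix.gram_nonneg (!![1, (a : A); 0, d] : Fin 2 → Fin 2 → A)
  have hmem : (CStarMatrix.ofMatrix (fun i j => ∑ k, star ((!![1, (a : A); 0, d] :
      Fin 2 → Fin 2 → A) k i) * (!![1, (a : A); 0, d] : Fin 2 → Fin 2 → A) k j) :
      CStarMatrix (Fin 2) (Fin 2) A) ∈ matrixSpace E 2 := by
    have h1 : (1 : A) ∈ E := hE.one_mem
    have h2 : ((‖(a : A)‖ ^ 2 : ℝ) : ℂ) • (1 : A) ∈ E := E.smul_mem _ h1
    rw [← hd] at h2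
    intro i j
    change ∑ k, star ((!![1, (a : A); 0, d] :
      Fin 2 → Fin 2 → A) k i) * (!![1, (a : A); 0, d] : Fin 2 → Fin 2 → A) k j ∈ E
    fin_cases i <;> fin_cases j <;> simp [Fin.sum_univ_two, h1, h2, hE.star_mem _ a.2]
  have h := CStarMatrix.star_apply_of_isSelfAdjoint
    (IsSelfAdjoint.of_nonneg (hu 2 ⟨_, hmem⟩ hpos)) (i := 0) (j := 1)
  have h01 : amplification u 2 ⟨_, hmem⟩ 0 1 = u a := congrArg u (Subtype.ext (by
    change ∑ k, star ((!![1, (a : A); 0, d] :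
      Fin 2 → Fin 2 → A) k 0) * (!![1, (a : A); 0, d] : Fin 2 → Fin 2 → A) k 1 = a
    simp [Fin.sum_univ_two]))
  have h10 : amplification u 2 ⟨_, hmem⟩ 1 0 = u ⟨star a, hE.star_mem a a.2⟩ :=
    congrArg u (Subtype.ext (by
      change ∑ k, star ((!![1, (a : A); 0, d] :
        Fin 2 → Fin 2 → A) k 1) * (!![1, (a : A); 0, d] : Fin 2 → Fin 2 → A) k 0 = star (a : A)
      simp [Fin.sum_univ_two]))
  rw [← h10, ← h, h01]

open FinsuppMatrix in
/-- Arveson's extension theorem and Stinespring's theorem combined. -/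
theorem IsCompletelyPositive.exists_dilation (hu : IsCompletelyPositive u)
    (hE : IsOperatorSystem E) :
    ∃ (H : Type (max uA uK w)) (_ : NormedAddCommGroup H) (_ : InnerProductSpace ℂ H)
      (_ : CompleteSpace H) (π : A →⋆ₐ[ℂ] (H →L[ℂ] H)) (V : K →L[ℂ] H),
      ‖V‖ ≤ √‖u ⟨1, hE.one_mem⟩‖ ∧
        ∀ a : E, u a = (ContinuousLinearMap.adjoint V).comp ((π (a : A)).comp V) := by
  -- The index type is lifted so that the GNS space lands in the universe `max uA uK w`.
  let I : Type (max uK w) := ULift.{w} (Module.Basis.ofVectorSpaceIndex ℂ K)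
  let b : Module.Basis I ℂ K := (Module.Basis.ofVectorSpace ℂ K).reindex Equiv.ulift.symm
  let T : (I × I →₀ E) →ₗ[ℂ] (I × I →₀ A) := Finsupp.mapRange.linearMap E.subtype
  let F : (I × I →₀ E) →ₗ[ℂ] ℂ := Finsupp.lsum ℂ fun q => coeffMap u (b q.1) (b q.2)
  have hTs : ∀ i j (a : E), T (Finsupp.single (i, j) a) = Finsupp.single (i, j) (a : A) :=
    fun i j a => by simp [T]
  have hFs : ∀ i j (a : E), F (Finsupp.single (i, j) a) = ⟪b i, u a (b j)⟫_ℂ :=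
    fun i j a => by simp [F]
  have hF : ∀ p, T p ∈ accretiveCone I A → 0 ≤ (F p).re := by
    classical
    intro p hp
    obtain ⟨n, e, he, hcov⟩ :=
      Finset.exists_fin_enum (p.support.image Prod.fst ∪ p.support.image Prod.snd)
    have hFp : F p = ∑ i, ∑ j, ⟪b (e i), u (p (e i, e j)) (b (e j))⟫_ℂ := by
      change p.sum (fun q => coeffMap u (b q.1) (b q.2)) = _
      rw [Finsupp.sum_prod_eq_sum_fin p _ (by simp) he]
      · rfl
      · exact fun q hq => ⟨hcov _ (Finset.mem_union_left _ (Finset.mem_image_of_mem _ hq)),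
          hcov _ (Finset.mem_union_right _ (Finset.mem_image_of_mem _ hq))⟩
    have hpos := hp (Fin n) e
    let x : matrixSpace E n := ⟨_, fun i j =>
      E.add_mem (p (e i, e j)).2 (hE.star_mem _ (p (e j, e i)).2)⟩
    have h := CStarMatrix.sum_inner_nonneg (StarAlgHom.id ℂ (K →L[ℂ] K)) (hu n x hpos)
      fun i => b (e i)
    have hx : ∀ i j, amplification u n x i j = u (p (e i, e j)) + star (u (p (e j, e i))) :=
      fun i j => by
        rw [← hu.map_star hE, ← map_add]
        rfl
    -- Since `x` is the compression of `p + p*` and `u` preserves adjoints, the form of `u_n(x)` at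
    -- the basis vectors is `2 Re F p`.
    have hsum : ∑ i, ∑ j, ⟪b (e i), (StarAlgHom.id ℂ (K →L[ℂ] K)) (amplification u n x i j)
        (b (e j))⟫_ℂ = F p + conj (F p) := by
      have hconj : conj (F p) = ∑ i, ∑ j, conj ⟪b (e j), u (p (e j, e i)) (b (e i))⟫_ℂ := by
        rw [hFp, Finset.sum_comm, map_sum]
        exact Finset.sum_congr rfl fun i _ => map_sum _ _ _
      rw [hconj, hFp, ← Finset.sum_add_distrib]
      refine Finset.sum_congr rfl fun i _ => ?_
      rw [← Finset.sum_add_distrib]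
      refine Finset.sum_congr rfl fun j _ => ?_
      change ⟪b (e i), amplification u n x i j (b (e j))⟫_ℂ = _
      rw [inner_conj_symm, hx, _root_.add_apply, inner_add_right,
        ContinuousLinearMap.star_eq_adjoint, ContinuousLinearMap.adjoint_inner_right]
    rw [hsum, Complex.add_re, Complex.conj_re] at h
    linarith
  obtain ⟨H, _, _, _, π, ξ, hξ⟩ := exists_representation T F hF
    fun i => ⟨Finsupp.single (i, i) ⟨1, hE.one_mem⟩, hTs _ _ _⟩
  have hcoef : ∀ i j (a : E), ⟪ξ i, π a (ξ j)⟫_ℂ = ⟪b i, u a (b j)⟫_ℂ := fun i j a => by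
    rw [hξ _ i j a (hTs i j a), hFs]
  obtain ⟨V, hV, hVb⟩ := b.exists_clm_of_inner ξ (u ⟨1, hE.one_mem⟩) fun i j => by
    rw [← hcoef]
    simp
  refine ⟨H, inferInstance, inferInstance, inferInstance, π, V, hV, fun a => ?_⟩
  refine ContinuousLinearMap.eq_adjoint_comp_of_basis b V V (π a) (u a) fun i j => ?_
  rw [hVb, hVb, hcoef]

end CompletelyPositive

/-! ### Normalising matrices with scalar Gram matrix. -/

section Scaling

open Matrix

variable {A : Type*} [CStarAlgebra A] [PartialOrder A] [StarOrderedRing A] [Nontrivial A]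
  {ι κ : Type*} [Fintype ι] [Fintype κ]

-- In `A`, the scalar `z*Lz` equals `(Pz)*(Pz) ≥ 0`. As `A` is nontrivial, the scalar lies in its
-- own spectrum, so it is nonnegative in `ℂ`.
open scoped ComplexOrder in
lemma posSemidef_of_conjTranspose_mul_self_eq {P : Matrix κ ι A} {L : Matrix ι ι ℂ}
    (hP : Pᴴ * P = L.map (algebraMap ℂ A)) : L.PosSemidef := by
  refine .of_dotProduct_mulVec_nonneg ?_ fun z => ?_
  · ext i j
    refine (algebraMap ℂ A).injective ?_
    have h := congrFun₂ (congrArg conjTranspose hP) i j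
    rw [conjTranspose_mul, conjTranspose_conjTranspose, hP] at h
    simp only [map_apply, conjTranspose_apply] at h ⊢
    rw [h, ← algebraMap_star_comm]
  · have h : algebraMap ℂ A (star z ⬝ᵥ L *ᵥ z) =
        star (P *ᵥ (algebraMap ℂ A ∘ z)) ⬝ᵥ (P *ᵥ (algebraMap ℂ A ∘ z)) := by
      rw [RingHom.map_dotProduct, star_mulVec, ← dotProduct_mulVec, mulVec_mulVec, hP]
      congr 1
      · ext i
        exact algebraMap_star_comm _
      · ext i
        simp [RingHom.map_mulVec]
    have h0 : 0 ≤ algebraMap ℂ A (star z ⬝ᵥ L *ᵥ z) := by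
      rw [h]
      exact Finset.sum_nonneg fun k _ => star_mul_self_nonneg _
    exact spectrum_nonneg_of_nonneg h0 (by simp)

variable [DecidableEq ι]

open scoped ComplexOrder MatrixOrder in
/-- A matrix over `A` with scalar Gram matrix `L` becomes a contraction after multiplication
by an inverse of a square root of `L + ε`. -/
lemma exists_scaling {P : Matrix κ ι A} {L : Matrix ι ι ℂ}
    (hP : Pᴴ * P = L.map (algebraMap ℂ A)) {ε : ℝ} (hε : 0 < ε) :
    ∃ B S : Matrix ι ι ℂ, S * B = 1 ∧ Bᴴ * B = L + diagonal (fun _ => (ε : ℂ)) ∧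
      (CStarMatrix.ofMatrix ((P * S.map (algebraMap ℂ A))ᴴ * (P * S.map (algebraMap ℂ A))) :
        CStarMatrix ι ι A) ≤ 1 := by
  have hL : (L + diagonal (fun _ : ι => (ε : ℂ))).PosDef :=
    .posSemidef_add (posSemidef_of_conjTranspose_mul_self_eq hP)
      (.diagonal fun _ => Complex.zero_lt_real.mpr hε)
  obtain ⟨B, hB⟩ := CStarAlgebra.nonneg_iff_eq_star_mul_self.mp hL.posSemidef.nonneg
  rw [star_eq_conjTranspose] at hB
  have hdet : IsUnit B.det := by
    have h := hL.det_pos.ne'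
    rw [hB, det_mul] at h
    exact (right_ne_zero_of_mul h).isUnit
  refine ⟨B, B⁻¹, nonsing_inv_mul B hdet, hB.symm, ?_⟩
  set S := B⁻¹ with hS
  have hBS : B * S = 1 := mul_nonsing_inv B hdet
  have hmapstar : ∀ M : Matrix ι ι ℂ, (M.map (algebraMap ℂ A))ᴴ = Mᴴ.map (algebraMap ℂ A) :=
    fun M => by
      ext i j
      exact (algebraMap_star_comm _).symm
  -- Consequently `1 - (PS)ᴴ(PS) = ε SᴴS`, the Gram matrix of `√ε S`, which is positive.
  have hone : Sᴴ * (L + diagonal (fun _ : ι => (ε : ℂ))) * S = 1 := by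
    rw [hB, Matrix.mul_assoc, Matrix.mul_assoc, hBS, Matrix.mul_one, ← conjTranspose_mul, hBS,
      conjTranspose_one]
  have hgram : (P * S.map (algebraMap ℂ A))ᴴ * (P * S.map (algebraMap ℂ A)) =
      (Sᴴ * L * S).map (algebraMap ℂ A) := by
    rw [conjTranspose_mul, Matrix.mul_assoc, ← Matrix.mul_assoc Pᴴ, hP, hmapstar, ← Matrix.map_mul,
      ← Matrix.map_mul, Matrix.mul_assoc]
  have hrest : (((√ε : ℂ) • S).map (algebraMap ℂ A))ᴴ * ((√ε : ℂ) • S).map (algebraMap ℂ A) =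
      (Sᴴ * diagonal (fun _ : ι => (ε : ℂ)) * S).map (algebraMap ℂ A) := by
    rw [hmapstar, ← Matrix.map_mul]
    congr 1
    have h1 : (diagonal (fun _ : ι => (ε : ℂ))) = (ε : ℂ) • (1 : Matrix ι ι ℂ) := by
      rw [smul_one_eq_diagonal]
    rw [h1, conjTranspose_smul, Matrix.smul_mul, Matrix.mul_smul, smul_smul, Matrix.mul_smul,
      Matrix.mul_one, Matrix.smul_mul]
    congr 1
    simp [← Complex.ofReal_mul, Real.mul_self_sqrt hε.le]
  have hnonneg := CStarMatrix.gram_nonneg (((√ε : ℂ) • S).map (algebraMap ℂ A))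
  rw [← sub_nonneg]
  convert hnonneg using 1
  have h2 : (1 : Matrix ι ι A) - (P * S.map (algebraMap ℂ A))ᴴ * (P * S.map (algebraMap ℂ A)) =
      (((√ε : ℂ) • S).map (algebraMap ℂ A))ᴴ * ((√ε : ℂ) • S).map (algebraMap ℂ A) := by
    rw [hgram, hrest, sub_eq_iff_eq_add, ← Matrix.map_add _ (map_add _), ← Matrix.add_mul,
      ← Matrix.mul_add, add_comm _ L, hone, Matrix.map_one _ (map_zero _) (map_one _)]
  exact h2

end Scaling

/-! ### Complete contractions and positivity of Paulsen's functional. -/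

section CompleteContraction

variable {A : Type*} [CStarAlgebra A] [PartialOrder A] [StarOrderedRing A]
  {K : Type*} [NormedAddCommGroup K] [InnerProductSpace ℂ K] [CompleteSpace K]
  {E : Submodule ℂ A} {u : E →ₗ[ℂ] (K →L[ℂ] K)}

lemma norm_amplification_le_one (hu : cbNorm u ≤ 1) {n : ℕ} (hn : 1 ≤ n) {x : matrixSpace E n}
    (hx : ‖x‖ ≤ 1) : ‖amplification u n x‖ ≤ 1 := by
  have h : ‖amplification u n x‖ₑ ≤ 1 :=
    (le_iSup₂_of_le (f := fun (x : matrixSpace E n) (_ : ‖x‖ ≤ 1) => ‖amplification u n x‖ₑ)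
      x hx le_rfl).trans ((le_iSup₂_of_le (f := fun (n : ℕ) (_ : 1 ≤ n) => amplificationNorm u n)
      n hn le_rfl).trans hu)
  rwa [← ofReal_norm, ENNReal.ofReal_le_one] at h

lemma cbNorm_le_one (h : ∀ (n : ℕ) (x : matrixSpace E n), ‖x‖ ≤ 1 → ‖amplification u n x‖ ≤ 1) :
    cbNorm u ≤ 1 :=
  iSup₂_le fun n _ => iSup₂_le fun x hx => by
    rw [← ofReal_norm, ENNReal.ofReal_le_one]
    exact h n x hx

lemma norm_apply_one_le_one (hu : cbNorm u ≤ 1) (h1 : (1 : A) ∈ E) : ‖u ⟨1, h1⟩‖ ≤ 1 := by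
  have hmem : (1 : CStarMatrix (Fin 1) (Fin 1) A) ∈ matrixSpace E 1 := fun i j => by
    rw [Subsingleton.elim i j, CStarMatrix.one_apply_eq]
    exact h1
  have hnorm : ‖(⟨1, hmem⟩ : matrixSpace E 1)‖ ≤ 1 :=
    CStarMatrix.norm_le_one_iff_star_mul_self_le.mpr (by simp)
  exact (CStarMatrix.norm_entry_le_norm (i := (0 : Fin 1)) (j := (0 : Fin 1))).trans
    (norm_amplification_le_one hu le_rfl hnorm)

/-- Contractive matrices of operators have numerical values bounded by the
arithmetic mean of the squared norms. -/
lemma neg_le_two_mul_re_sum_inner {ι : Type*} [Fintype ι] [DecidableEq ι]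
    {d : CStarMatrix ι ι (K →L[ℂ] K)} (hd : ‖d‖ ≤ 1) (g h : ι → K) :
    -(∑ i, ‖g i‖ ^ 2 + ∑ i, ‖h i‖ ^ 2) ≤ 2 * (∑ i, ∑ j, ⟪g i, d i j (h j)⟫_ℂ).re := by
  have h1 : ∑ k, ‖∑ j, d k j (h j)‖ ^ 2 ≤ ∑ j, ‖h j‖ ^ 2 :=
    CStarMatrix.sum_norm_sq_le_of_norm_le_one (StarAlgHom.id ℂ (K →L[ℂ] K)) hd h
  have h2 : -(∑ i, ‖g i‖ ^ 2 + ∑ i, ‖∑ j, d i j (h j)‖ ^ 2) ≤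
      2 * (∑ i, ∑ j, ⟪g i, d i j (h j)⟫_ℂ).re := by
    rw [← Finset.sum_add_distrib, ← Finset.sum_neg_distrib, Complex.re_sum, Finset.mul_sum]
    refine Finset.sum_le_sum fun i _ => ?_
    rw [← inner_sum]
    have h3 := norm_add_sq (𝕜 := ℂ) (g i) (∑ j, d i j (h j))
    have h4 : 0 ≤ ‖g i + ∑ j, d i j (h j)‖ ^ 2 := by positivity
    have h5 : RCLike.re ⟪g i, ∑ j, d i j (h j)⟫_ℂ = (⟪g i, ∑ j, d i j (h j)⟫_ℂ).re := rfl
    rw [h5] at h3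
    linarith
  linarith

end CompleteContraction

section ChangeOfBasis

open Matrix

variable {ι : Type*} [Fintype ι] [DecidableEq ι]

lemma sum_smul_sum_smul_of_mul_eq_one {M : Type*} [AddCommGroup M] [Module ℂ M]
    {S B : Matrix ι ι ℂ} (hSB : S * B = 1) (h : ι → M) (l : ι) :
    ∑ i, S l i • ∑ m, B i m • h m = h l := by
  simp_rw [Finset.smul_sum, smul_smul]
  rw [Finset.sum_comm]
  simp_rw [← Finset.sum_smul, ← mul_apply, hSB, one_apply]
  simp

/-- This is `⟪Bh, (S* R S') B'h⟫ = ⟪SBh, R S'B'h⟫ = ⟪h, R h⟫`: rescaling the matrix is undone by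
rescaling the vectors. -/
lemma sum_inner_eq_of_inverse {K : Type*} [NormedAddCommGroup K] [InnerProductSpace ℂ K]
    {S B S' B' : Matrix ι ι ℂ} (hSB : S * B = 1) (hSB' : S' * B' = 1)
    (R : ι → ι → (K →L[ℂ] K)) (h : ι → K) :
    ∑ i, ∑ j, ⟪∑ l, B i l • h l,
        (∑ l, ∑ m, (conj (S l i) * S' m j) • R l m) (∑ m, B' j m • h m)⟫_ℂ =
      ∑ l, ∑ m, ⟪h l, R l m (h m)⟫_ℂ := by
  have h1 : ∀ l m, ⟪h l, R l m (h m)⟫_ℂ = ∑ i, ∑ j,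
      (conj (S l i) * S' m j) * ⟪∑ l, B i l • h l, R l m (∑ m, B' j m • h m)⟫_ℂ := fun l m => by
    conv_lhs => rw [← sum_smul_sum_smul_of_mul_eq_one hSB h l,
      ← sum_smul_sum_smul_of_mul_eq_one hSB' h m]
    rw [sum_inner]
    refine Finset.sum_congr rfl fun i _ => ?_
    rw [map_sum, inner_sum]
    refine Finset.sum_congr rfl fun j _ => ?_
    rw [map_smul, inner_smul_left, inner_smul_right, mul_assoc]
  have h2 : ∀ i j, ⟪∑ l, B i l • h l,
        (∑ l, ∑ m, (conj (S l i) * S' m j) • R l m) (∑ m, B' j m • h m)⟫_ℂ = ∑ l, ∑ m,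
      (conj (S l i) * S' m j) * ⟪∑ l, B i l • h l, R l m (∑ m, B' j m • h m)⟫_ℂ := fun i j => by
    rw [_root_.sum_apply, inner_sum]
    refine Finset.sum_congr rfl fun l _ => ?_
    rw [_root_.sum_apply, inner_sum]
    refine Finset.sum_congr rfl fun m _ => ?_
    rw [_root_.smul_apply, inner_smul_right]
  simp_rw [h1, h2]
  calc _ = ∑ i, ∑ l, ∑ j, ∑ m, (conj (S l i) * S' m j) *
          ⟪∑ l, B i l • h l, R l m (∑ m, B' j m • h m)⟫_ℂ :=
        Finset.sum_congr rfl fun i _ => Finset.sum_comm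
    _ = ∑ l, ∑ i, ∑ j, ∑ m, (conj (S l i) * S' m j) *
          ⟪∑ l, B i l • h l, R l m (∑ m, B' j m • h m)⟫_ℂ := Finset.sum_comm
    _ = ∑ l, ∑ i, ∑ m, ∑ j, (conj (S l i) * S' m j) *
          ⟪∑ l, B i l • h l, R l m (∑ m, B' j m • h m)⟫_ℂ :=
        Finset.sum_congr rfl fun l _ => Finset.sum_congr rfl fun i _ => Finset.sum_comm
    _ = _ := Finset.sum_congr rfl fun l _ => Finset.sum_comm

end ChangeOfBasis

section CompleteContraction

open Matrix

variable {A : Type*} [CStarAlgebra A] [PartialOrder A] [StarOrderedRing A]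
  {K : Type*} [NormedAddCommGroup K] [InnerProductSpace ℂ K] [CompleteSpace K]
  {E : Submodule ℂ A} {u : E →ₗ[ℂ] (K →L[ℂ] K)} {ι κ : Type*} [Fintype ι] [Fintype κ]
  [DecidableEq ι]

lemma sum_norm_sq_matrix_smul {L B : Matrix ι ι ℂ} {ε : ℝ}
    (hB : Bᴴ * B = L + diagonal (fun _ => (ε : ℂ))) (h : ι → K) :
    ∑ i, ‖∑ j, B i j • h j‖ ^ 2 =
      (∑ i, ∑ j, L i j * ⟪h i, h j⟫_ℂ).re + ε * ∑ i, ‖h i‖ ^ 2 := by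
  have h1 := CStarMatrix.sum_inner_gram (fun k i => B k i • (1 : K →L[ℂ] K)) h
  simp only [_root_.smul_apply, one_apply_eq_self] at h1
  have h2 : ∀ i j, ⟪h i, (∑ k, star (B k i • (1 : K →L[ℂ] K)) * B k j • (1 : K →L[ℂ] K)) (h j)⟫_ℂ =
      L i j * ⟪h i, h j⟫_ℂ + (if i = j then (ε : ℂ) else 0) * ⟪h i, h j⟫_ℂ := fun i j => by
    have h3 : ∑ k, star (B k i • (1 : K →L[ℂ] K)) * B k j • (1 : K →L[ℂ] K) =
        ((Bᴴ * B) i j) • (1 : K →L[ℂ] K) := by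
      rw [mul_apply, Finset.sum_smul]
      refine Finset.sum_congr rfl fun k _ => ?_
      rw [star_smul, star_one, smul_mul_smul_comm, one_mul, conjTranspose_apply]
    rw [h3, hB, _root_.smul_apply, one_apply_eq_self, inner_smul_right, Matrix.add_apply,
      diagonal_apply, add_mul]
  simp_rw [h2, Finset.sum_add_distrib] at h1
  have h4 : ∑ i, ∑ j, (if i = j then (ε : ℂ) else 0) * ⟪h i, h j⟫_ℂ =
      ((ε * ∑ i, ‖h i‖ ^ 2 : ℝ) : ℂ) := by
    push_cast
    rw [Finset.mul_sum]
    refine Finset.sum_congr rfl fun i _ => ?_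
    simp
  rw [h4] at h1
  have h5 := congrArg Complex.re h1
  rw [Complex.add_re, Complex.ofReal_re, Complex.ofReal_re] at h5
  exact h5.symm

/-- Positivity of Paulsen's functional on the matrices `[[L, x], [star x, M]]`. -/
lemma re_nonneg_of_gram [Nontrivial A] (hu : cbNorm u ≤ 1) {n : ℕ} {P Q : Matrix κ (Fin n) A}
    {L M : Matrix (Fin n) (Fin n) ℂ} (hP : Pᴴ * P = L.map (algebraMap ℂ A))
    (hQ : Qᴴ * Q = M.map (algebraMap ℂ A)) (x : Fin n → Fin n → E)
    (hx : ∀ i j, (x i j : A) = (Pᴴ * Q) i j) (h : Fin n → K) :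
    0 ≤ (∑ i, ∑ j, L i j * ⟪h i, h j⟫_ℂ).re + (∑ i, ∑ j, M i j * ⟪h i, h j⟫_ℂ).re +
      2 * (∑ i, ∑ j, ⟪h i, u (x i j) (h j)⟫_ℂ).re := by
  -- The supremum defining `cbNorm` starts at `n = 1`, so the empty matrix is treated apart.
  rcases Nat.eq_zero_or_pos n with rfl | hn
  · simp
  have key : ∀ ε : ℝ, 0 < ε → 0 ≤ (∑ i, ∑ j, L i j * ⟪h i, h j⟫_ℂ).re +
      (∑ i, ∑ j, M i j * ⟪h i, h j⟫_ℂ).re + 2 * (∑ i, ∑ j, ⟪h i, u (x i j) (h j)⟫_ℂ).re +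
      ε * (2 * ∑ i, ‖h i‖ ^ 2) := by
    intro ε hε
    obtain ⟨B, S, hSB, hB, hPS⟩ := exists_scaling hP hε
    obtain ⟨B', S', hSB', hB', hQS⟩ := exists_scaling hQ hε
    -- `c = Sᴴ(PᴴQ)S'` is a scalar transform of `x`, so its entries stay in `E`, and it is a
    -- contraction because `PS` and `QS'` are.
    let c : CStarMatrix (Fin n) (Fin n) A := CStarMatrix.ofMatrix
      ((P * S.map (algebraMap ℂ A))ᴴ * (Q * S'.map (algebraMap ℂ A)))
    have hc : ∀ i j, c i j = ((∑ l, ∑ m, (conj (S l i) * S' m j) • x l m : E) : A) := fun i j => by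
      have h1 : c i j = ((S.map (algebraMap ℂ A))ᴴ * ((Pᴴ * Q) * S'.map (algebraMap ℂ A))) i j := by
        change ((P * S.map (algebraMap ℂ A))ᴴ * (Q * S'.map (algebraMap ℂ A))) i j = _
        rw [conjTranspose_mul, Matrix.mul_assoc, Matrix.mul_assoc Pᴴ]
      rw [h1, mul_apply, AddSubmonoidClass.coe_finsetSum]
      refine Finset.sum_congr rfl fun l _ => ?_
      rw [mul_apply, AddSubmonoidClass.coe_finsetSum, Finset.mul_sum]
      refine Finset.sum_congr rfl fun m _ => ?_
      rw [Submodule.coe_smul, hx, conjTranspose_apply, map_apply, map_apply,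
        ← algebraMap_star_comm, ← Algebra.commutes, ← Algebra.smul_def, ← Algebra.smul_def,
        smul_smul]
      rfl
    let c' : matrixSpace E n := ⟨c, fun i j => by rw [hc]; exact Subtype.property _⟩
    have hcn : ‖c'‖ ≤ 1 := CStarMatrix.norm_gram_le_one
      (P := P * S.map (algebraMap ℂ A)) (Q := Q * S'.map (algebraMap ℂ A)) hPS hQS
    have hamp : ∀ i j, amplification u n c' i j =
        ∑ l, ∑ m, (conj (S l i) * S' m j) • u (x l m) := fun i j => by
      have h1 : amplification u n c' i j = u (∑ l, ∑ m, (conj (S l i) * S' m j) • x l m) :=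
        congrArg u (Subtype.ext (hc i j))
      rw [h1, map_sum]
      refine Finset.sum_congr rfl fun l _ => ?_
      rw [map_sum]
      exact Finset.sum_congr rfl fun m _ => map_smul _ _ _
    have hmain := neg_le_two_mul_re_sum_inner (norm_amplification_le_one hu hn hcn)
      (fun i => ∑ l, B i l • h l) (fun j => ∑ m, B' j m • h m)
    simp_rw [hamp] at hmain
    rw [sum_inner_eq_of_inverse hSB hSB' (fun l m => u (x l m)) h, sum_norm_sq_matrix_smul hB,
      sum_norm_sq_matrix_smul hB'] at hmain
    linarith
  -- Let `ε` tend to `0`. The choice `ε = δ / (C + 1)` also covers `C = 0`.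
  refine le_of_forall_pos_le_add fun δ hδ => ?_
  set C := 2 * ∑ i, ‖h i‖ ^ 2 with hC
  have hC0 : 0 ≤ C := by positivity
  refine (key (δ / (C + 1)) (by positivity)).trans ?_
  have : δ / (C + 1) * C ≤ δ := by
    rw [div_mul_eq_mul_div, div_le_iff₀ (by positivity)]
    nlinarith
  linarith

end CompleteContraction

/-! ### Block matrices and dilation of complete contractions. -/

section BlockMap

variable {A : Type*} [CStarAlgebra A]

/-- Place a finitely supported matrix, with a linear map applied to its entries, into a block of
a larger one. -/
def blockMap {I J M : Type*} [AddCommGroup M] [Module ℂ M] (f g : I → J) (φ : M →ₗ[ℂ] A) :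
    (I × I →₀ M) →ₗ[ℂ] (J × J →₀ A) :=
  Finsupp.lmapDomain A ℂ (Prod.map f g) ∘ₗ Finsupp.mapRange.linearMap φ

variable {I J M : Type*} [AddCommGroup M] [Module ℂ M] {f g : I → J} {φ : M →ₗ[ℂ] A}

lemma blockMap_apply (hf : Function.Injective f) (hg : Function.Injective g) (x : I × I →₀ M)
    (i j : I) : blockMap f g φ x (f i, g j) = φ (x (i, j)) :=
  Finsupp.mapDomain_apply (hf.prodMap hg) _ (i, j)

lemma blockMap_apply_of_left_notMem {p : J} (hp : p ∉ Set.range f) (x : I × I →₀ M) (q : J) :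
    blockMap f g φ x (p, q) = 0 :=
  Finsupp.mapDomain_of_notMem_range _ _ fun ⟨r, hr⟩ => hp ⟨r.1, congrArg Prod.fst hr⟩

lemma blockMap_apply_of_right_notMem {q : J} (hq : q ∉ Set.range g) (x : I × I →₀ M) (p : J) :
    blockMap f g φ x (p, q) = 0 :=
  Finsupp.mapDomain_of_notMem_range _ _ fun ⟨r, hr⟩ => hq ⟨r.2, congrArg Prod.snd hr⟩

lemma blockMap_single (i j : I) (a : M) :
    blockMap f g φ (Finsupp.single (i, j) a) = Finsupp.single (f i, g j) (φ a) := by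
  simp [blockMap]

end BlockMap

section CompletelyContractive

variable {A : Type uA} [CStarAlgebra A] [PartialOrder A] [StarOrderedRing A]
  {K : Type uK} [NormedAddCommGroup K] [InnerProductSpace ℂ K] [CompleteSpace K]
  {E : Submodule ℂ A} {u : E →ₗ[ℂ] (K →L[ℂ] K)}

open FinsuppMatrix Matrix in
/-- The factorisation theorem for completely contractive maps into `B(K)`. -/
theorem exists_dilation_of_cbNorm_le_one [Nontrivial A] (hu : cbNorm u ≤ 1) :
    ∃ (H : Type (max uA uK w)) (_ : NormedAddCommGroup H) (_ : InnerProductSpace ℂ H)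
      (_ : CompleteSpace H) (π : A →⋆ₐ[ℂ] (H →L[ℂ] H)) (V W : K →L[ℂ] H),
      ‖V‖ ≤ 1 ∧ ‖W‖ ≤ 1 ∧
        ∀ a : E, u a = (ContinuousLinearMap.adjoint V).comp ((π (a : A)).comp W) := by
  let I : Type (max uK w) := ULift.{w} (Module.Basis.ofVectorSpaceIndex ℂ K)
  let b : Module.Basis I ℂ K := (Module.Basis.ofVectorSpace ℂ K).reindex Equiv.ulift.symm
  -- The parameters are the upper triangular block matrices `[[l, x], [0, r]]`. The lower corner may
  -- be zero because the cone sees only the real part, so no adjoint copy of `E` is needed.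
  let P := ((I × I →₀ ℂ) × (I × I →₀ ℂ)) × (I × I →₀ E)
  let Tl : (I × I →₀ ℂ) →ₗ[ℂ] ((I ⊕ I) × (I ⊕ I) →₀ A) :=
    blockMap Sum.inl Sum.inl (Algebra.linearMap ℂ A)
  let Tr : (I × I →₀ ℂ) →ₗ[ℂ] ((I ⊕ I) × (I ⊕ I) →₀ A) :=
    blockMap Sum.inr Sum.inr (Algebra.linearMap ℂ A)
  let Te : (I × I →₀ E) →ₗ[ℂ] ((I ⊕ I) × (I ⊕ I) →₀ A) := blockMap Sum.inl Sum.inr E.subtype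
  let T : P →ₗ[ℂ] ((I ⊕ I) × (I ⊕ I) →₀ A) := (Tl.coprod Tr).coprod Te
  let Fs : (I × I →₀ ℂ) →ₗ[ℂ] ℂ := Finsupp.lsum ℂ fun q => LinearMap.mulRight ℂ ⟪b q.1, b q.2⟫_ℂ
  let Fe : (I × I →₀ E) →ₗ[ℂ] ℂ := Finsupp.lsum ℂ fun q => coeffMap u (b q.1) (b q.2)
  let F : P →ₗ[ℂ] ℂ := (Fs.coprod Fs).coprod Fe
  have hFs : ∀ i j (c : ℂ), Fs (Finsupp.single (i, j) c) = c * ⟪b i, b j⟫_ℂ :=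
    fun i j a => by simp [Fs]
  have hFe : ∀ i j (a : E), Fe (Finsupp.single (i, j) a) = ⟪b i, u a (b j)⟫_ℂ :=
    fun i j a => by simp [Fe]
  have hT : ∀ l r x, T ((l, r), x) = Tl l + Tr r + Te x := fun l r x => rfl
  have hFapp : ∀ l r x, F ((l, r), x) = Fs l + Fs r + Fe x := fun l r x => rfl
  have hTl : ∀ i, T ((Finsupp.single (i, i) 1, 0), 0) =
      Finsupp.single (Sum.inl i, Sum.inl i) 1 := fun i => by
    simp [hT, Tl, blockMap_single]
  have hTr : ∀ i, T ((0, Finsupp.single (i, i) 1), 0) =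
      Finsupp.single (Sum.inr i, Sum.inr i) 1 := fun i => by
    simp [hT, Tr, blockMap_single]
  have hF : ∀ p, T p ∈ accretiveCone (I ⊕ I) A → 0 ≤ (F p).re := by
    classical
    rintro ⟨⟨l, r⟩, x⟩ hp
    obtain ⟨n, e, he, hcov⟩ := Finset.exists_fin_enum
      ((l.support ∪ r.support ∪ x.support).image Prod.fst ∪
        (l.support ∪ r.support ∪ x.support).image Prod.snd)
    have hcov' : ∀ q ∈ l.support ∪ r.support ∪ x.support,
        q.1 ∈ Set.range e ∧ q.2 ∈ Set.range e := fun q hq =>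
      ⟨hcov _ (Finset.mem_union_left _ (Finset.mem_image_of_mem _ hq)),
        hcov _ (Finset.mem_union_right _ (Finset.mem_image_of_mem _ hq))⟩
    have hFse : ∀ y : I × I →₀ ℂ, y.support ⊆ l.support ∪ r.support ∪ x.support →
        Fs y = ∑ i, ∑ j, y (e i, e j) * ⟪b (e i), b (e j)⟫_ℂ := fun y hy =>
      Finsupp.sum_prod_eq_sum_fin y
        (fun q => LinearMap.mulRight ℂ ⟪b q.1, b q.2⟫_ℂ) (by simp) he fun q hq => hcov' q (hy hq)
    have hFee : Fe x = ∑ i, ∑ j, ⟪b (e i), u (x (e i, e j)) (b (e j))⟫_ℂ :=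
      Finsupp.sum_prod_eq_sum_fin x (fun q => coeffMap u (b q.1) (b q.2)) (by simp) he
        fun q hq => hcov' q (Finset.mem_union_right _ hq)
    have hpos := hp (Fin n ⊕ Fin n) (Sum.map e e)
    obtain ⟨R, hR⟩ := CStarMatrix.exists_gram hpos
    replace hR : ∀ i j, T ((l, r), x) (Sum.map e e i, Sum.map e e j) +
        star (T ((l, r), x) (Sum.map e e j, Sum.map e e i)) = ∑ k, star (R k i) * R k j := hR
    have hll : ∀ i j, T ((l, r), x) (Sum.inl i, Sum.inl j) = algebraMap ℂ A (l (i, j)) :=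
      fun i j => by
        rw [hT, Finsupp.add_apply, Finsupp.add_apply,
          blockMap_apply Sum.inl_injective Sum.inl_injective,
          blockMap_apply_of_left_notMem (by simp), blockMap_apply_of_right_notMem (by simp)]
        simp
    have hrr : ∀ i j, T ((l, r), x) (Sum.inr i, Sum.inr j) = algebraMap ℂ A (r (i, j)) :=
      fun i j => by
        rw [hT, Finsupp.add_apply, Finsupp.add_apply,
          blockMap_apply Sum.inr_injective Sum.inr_injective,
          blockMap_apply_of_left_notMem (by simp), blockMap_apply_of_left_notMem (by simp)]
        simp
    have hlr : ∀ i j, T ((l, r), x) (Sum.inl i, Sum.inr j) = (x (i, j) : A) := fun i j => by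
      rw [hT, Finsupp.add_apply, Finsupp.add_apply,
        blockMap_apply Sum.inl_injective Sum.inr_injective,
        blockMap_apply_of_right_notMem (by simp), blockMap_apply_of_left_notMem (by simp)]
      simp
    have hrl : ∀ i j, T ((l, r), x) (Sum.inr i, Sum.inl j) = 0 := fun i j => by
      rw [hT, Finsupp.add_apply, Finsupp.add_apply,
        blockMap_apply_of_left_notMem (by simp),
        blockMap_apply_of_right_notMem (by simp), blockMap_apply_of_left_notMem (by simp)]
      simp
    -- Splitting the columns of the root `R` of the real part into `X` and `Y` gives `XᴴX = l + l*`,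
    -- `YᴴY = r + r*` and `XᴴY = x`.
    let X : Matrix (Fin n ⊕ Fin n) (Fin n) A := Matrix.of fun k i => R k (Sum.inl i)
    let Y : Matrix (Fin n ⊕ Fin n) (Fin n) A := Matrix.of fun k i => R k (Sum.inr i)
    let L : Matrix (Fin n) (Fin n) ℂ := Matrix.of fun i j => l (e i, e j) + conj (l (e j, e i))
    let M : Matrix (Fin n) (Fin n) ℂ := Matrix.of fun i j => r (e i, e j) + conj (r (e j, e i))
    have hX : Xᴴ * X = L.map (algebraMap ℂ A) := by
      ext i j
      refine (hR (Sum.inl i) (Sum.inl j)).symm.trans ?_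
      rw [Sum.map_inl, Sum.map_inl, hll, hll, ← algebraMap_star_comm, ← map_add]
      rfl
    have hY : Yᴴ * Y = M.map (algebraMap ℂ A) := by
      ext i j
      refine (hR (Sum.inr i) (Sum.inr j)).symm.trans ?_
      rw [Sum.map_inr, Sum.map_inr, hrr, hrr, ← algebraMap_star_comm, ← map_add]
      rfl
    have hXY : ∀ i j, (x (e i, e j) : A) = (Xᴴ * Y) i j := fun i j => by
      refine Eq.trans ?_ (hR (Sum.inl i) (Sum.inr j))
      rw [Sum.map_inl, Sum.map_inr, hlr, hrl, star_zero, add_zero]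
    have hmain := re_nonneg_of_gram hu hX hY (fun i j => x (e i, e j)) hXY fun i => b (e i)
    have hherm : ∀ y : I × I →₀ ℂ, (∑ i, ∑ j, (y (e i, e j) + conj (y (e j, e i))) *
        ⟪b (e i), b (e j)⟫_ℂ).re = 2 * (∑ i, ∑ j, y (e i, e j) * ⟪b (e i), b (e j)⟫_ℂ).re :=
      fun y => by
        have hconj : conj (∑ i, ∑ j, y (e i, e j) * ⟪b (e i), b (e j)⟫_ℂ) =
            ∑ i, ∑ j, conj (y (e j, e i)) * ⟪b (e i), b (e j)⟫_ℂ := by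
          rw [Finset.sum_comm, map_sum]
          refine Finset.sum_congr rfl fun i _ => ?_
          rw [map_sum]
          refine Finset.sum_congr rfl fun j _ => ?_
          rw [map_mul, inner_conj_symm]
        simp_rw [add_mul, Finset.sum_add_distrib]
        rw [← hconj, Complex.add_re, Complex.conj_re, two_mul]
    have hL := hherm l
    have hM := hherm r
    have hL' : (∑ i, ∑ j, L i j * ⟪b (e i), b (e j)⟫_ℂ).re = _ := hL
    have hM' : (∑ i, ∑ j, M i j * ⟪b (e i), b (e j)⟫_ℂ).re = _ := hM
    rw [hL', hM'] at hmain
    rw [hFapp, hFse l (fun q hq => Finset.mem_union_left _ (Finset.mem_union_left _ hq)),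
      hFse r (fun q hq => Finset.mem_union_left _ (Finset.mem_union_right _ hq)), hFee,
      Complex.add_re, Complex.add_re]
    linarith
  obtain ⟨H, _, _, _, π, ξ, hξ⟩ := exists_representation T F hF (by
    rintro (i | i)
    exacts [⟨_, hTl i⟩, ⟨_, hTr i⟩])
  have hone : ‖(1 : K →L[ℂ] K)‖ ≤ 1 := ContinuousLinearMap.norm_id_le
  have hsqrt : √‖(1 : K →L[ℂ] K)‖ ≤ 1 := Real.sqrt_le_one.mpr hone
  -- On each diagonal block the functional is the Gram matrix of `b`, so each half of `ξ` defines a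
  -- contraction on `K`.
  have hl : ∀ i j, ⟪ξ (Sum.inl i), ξ (Sum.inl j)⟫_ℂ = ⟪b i, (1 : K →L[ℂ] K) (b j)⟫_ℂ :=
    fun i j => by
      have h := hξ ((Finsupp.single (i, j) 1, 0), 0) (Sum.inl i) (Sum.inl j) 1
        (by simp [hT, Tl, blockMap_single])
      rw [hFapp, hFs] at h
      simpa using h
  have hr : ∀ i j, ⟪ξ (Sum.inr i), ξ (Sum.inr j)⟫_ℂ = ⟪b i, (1 : K →L[ℂ] K) (b j)⟫_ℂ :=
    fun i j => by
      have h := hξ ((0, Finsupp.single (i, j) 1), 0) (Sum.inr i) (Sum.inr j) 1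
        (by simp [hT, Tr, blockMap_single])
      rw [hFapp, hFs] at h
      simpa using h
  obtain ⟨V, hV, hVb⟩ := b.exists_clm_of_inner (fun i => ξ (Sum.inl i)) 1 hl
  obtain ⟨W, hW, hWb⟩ := b.exists_clm_of_inner (fun i => ξ (Sum.inr i)) 1 hr
  refine ⟨H, inferInstance, inferInstance, inferInstance, π, V, W, hV.trans hsqrt, hW.trans hsqrt,
    fun a => ?_⟩
  refine ContinuousLinearMap.eq_adjoint_comp_of_basis b V W (π a) (u a) fun i j => ?_
  have h := hξ ((0, 0), Finsupp.single (i, j) a) (Sum.inl i) (Sum.inr j) a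
    (by simp [hT, Te, blockMap_single])
  rw [hFapp, hFe] at h
  rw [hVb, hWb, h]
  simp

end CompletelyContractive

/-! ### The converse directions. -/

section Compression

variable {A : Type*} [CStarAlgebra A] [PartialOrder A] [StarOrderedRing A]
  {K : Type*} [NormedAddCommGroup K] [InnerProductSpace ℂ K] [CompleteSpace K]
  {H : Type*} [NormedAddCommGroup H] [InnerProductSpace ℂ H] [CompleteSpace H]
  {E : Submodule ℂ A} {u : E →ₗ[ℂ] (K →L[ℂ] K)} {π : A →⋆ₐ[ℂ] (H →L[ℂ] H)}

lemma cbNorm_le_one_of_dilation {V W : K →L[ℂ] H} (hV : ‖V‖ ≤ 1) (hW : ‖W‖ ≤ 1)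
    (hu : ∀ a : E, u a = (ContinuousLinearMap.adjoint V).comp ((π (a : A)).comp W)) :
    cbNorm u ≤ 1 := by
  refine cbNorm_le_one fun n x hx =>
    CStarMatrix.norm_le_one_of_forall_sum_norm_sq_le fun h => ?_
  calc ∑ k, ‖∑ j, amplification u n x k j (h j)‖ ^ 2
      = ∑ k, ‖ContinuousLinearMap.adjoint V (∑ j, π (x.1 k j) (W (h j)))‖ ^ 2 := by
        refine Finset.sum_congr rfl fun k _ => ?_
        rw [map_sum]
        congr 2
        refine Finset.sum_congr rfl fun j _ => ?_
        change u ⟨x.1 k j, x.2 k j⟩ (h j) = _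
        rw [hu]
        rfl
    _ ≤ ∑ k, ‖∑ j, π (x.1 k j) (W (h j))‖ ^ 2 := by
        refine Finset.sum_le_sum fun k _ => ?_
        have h1 : ‖ContinuousLinearMap.adjoint V‖ ≤ 1 := by
          rwa [LinearIsometryEquiv.norm_map]
        have := (ContinuousLinearMap.adjoint V).le_of_opNorm_le h1
          (∑ j, π (x.1 k j) (W (h j)))
        gcongr
        simpa using this
    _ ≤ ∑ j, ‖W (h j)‖ ^ 2 := CStarMatrix.sum_norm_sq_le_of_norm_le_one π hx fun j => W (h j)
    _ ≤ ∑ j, ‖h j‖ ^ 2 := by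
        refine Finset.sum_le_sum fun k _ => ?_
        have := W.le_of_opNorm_le hW (h k)
        gcongr
        simpa using this

/-- The quadratic form of `u_n(x)` at `h` is that of `π` applied entrywise to `x`, taken at the
column `V h`. -/
lemma isCompletelyPositive_of_dilation {V : K →L[ℂ] H}
    (hu : ∀ a : E, u a = (ContinuousLinearMap.adjoint V).comp ((π (a : A)).comp V)) :
    IsCompletelyPositive u := fun n x hx => by
  have happ : ∀ i j, amplification u n x i j =
      (ContinuousLinearMap.adjoint V).comp ((π (x.1 i j)).comp V) := fun i j => hu _
  refine CStarMatrix.nonneg_of_forall_sum_inner ?_ fun h => ?_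
  · refine CStarMatrix.ext fun i j => ?_
    have hx' := CStarMatrix.star_apply_of_isSelfAdjoint (IsSelfAdjoint.of_nonneg hx)
      (i := j) (j := i)
    rw [CStarMatrix.star_apply, happ, happ, ← hx', map_star,
      ContinuousLinearMap.star_eq_adjoint, ContinuousLinearMap.star_eq_adjoint,
      ContinuousLinearMap.adjoint_comp, ContinuousLinearMap.adjoint_comp,
      ContinuousLinearMap.adjoint_adjoint]
    rfl
  · convert CStarMatrix.sum_inner_nonneg π hx fun i => V (h i) using 5 with i _ j _
    rw [happ]
    exact ContinuousLinearMap.adjoint_inner_right V _ _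

end Compression

end

theorem mainTheorem1
    {A : Type uA} [CStarAlgebra A] [PartialOrder A] [StarOrderedRing A]
    {K : Type uK} [NormedAddCommGroup K] [InnerProductSpace ℂ K] [CompleteSpace K]
    (E : Submodule ℂ A) (hE : IsOperatorSpace E) (u : E →ₗ[ℂ] (K →L[ℂ] K)) :
    ((IsCompletelyBounded u ∧ cbNorm u ≤ 1) ↔
      ∃ (H : Type (max uA uK w)) (_ : NormedAddCommGroup H) (_ : InnerProductSpace ℂ H)
        (_ : CompleteSpace H) (π : A →⋆ₐ[ℂ] (H →L[ℂ] H)) (V W : K →L[ℂ] H),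
        ‖V‖ ≤ 1 ∧ ‖W‖ ≤ 1 ∧
          ∀ a : E, u a = (ContinuousLinearMap.adjoint V).comp ((π (a : A)).comp W)) ∧
    (IsOperatorSystem E →
      (IsCompletelyPositive u ↔
        ∃ (H : Type (max uA uK w)) (_ : NormedAddCommGroup H) (_ : InnerProductSpace ℂ H)
          (_ : CompleteSpace H) (π : A →⋆ₐ[ℂ] (H →L[ℂ] H)) (V : K →L[ℂ] H),
          ∀ a : E, u a = (ContinuousLinearMap.adjoint V).comp ((π (a : A)).comp V)) ∧
      ((IsCompletelyPositive u ∧ cbNorm u ≤ 1) ↔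
        ∃ (H : Type (max uA uK w)) (_ : NormedAddCommGroup H) (_ : InnerProductSpace ℂ H)
          (_ : CompleteSpace H) (π : A →⋆ₐ[ℂ] (H →L[ℂ] H)) (V : K →L[ℂ] H),
          ‖V‖ ≤ 1 ∧
            ∀ a : E, u a = (ContinuousLinearMap.adjoint V).comp ((π (a : A)).comp V))) := by
  refine ⟨⟨fun h => ?_, ?_⟩, fun hS => ⟨⟨fun h => ?_, ?_⟩, ⟨fun h => ?_, ?_⟩⟩⟩
  -- If `A = 0`, scalars do not embed in `A`. Then `u = 0`, and the zero Hilbert space carries a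
  -- unital representation because `1 = 0` there.
  · rcases subsingleton_or_nontrivial A with hA | hA
    · refine ⟨PUnit, inferInstance, inferInstance, inferInstance,
        { toFun := fun _ => 0
          map_one' := Subsingleton.elim _ _
          map_mul' := fun _ _ => Subsingleton.elim _ _
          map_zero' := rfl
          map_add' := fun _ _ => Subsingleton.elim _ _
          commutes' := fun _ => Subsingleton.elim _ _
          map_star' := fun _ => Subsingleton.elim _ _ }, 0, 0, by simp, by simp, fun a => ?_⟩
      rw [Subsingleton.elim a 0, map_zero]
      simp
    · exact exists_dilation_of_cbNorm_le_one.{uA, uK, w} h.2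
  · rintro ⟨H, _, _, _, π, V, W, hV, hW, hu⟩
    have h := cbNorm_le_one_of_dilation hV hW hu
    exact ⟨h.trans_lt ENNReal.one_lt_top, h⟩
  · obtain ⟨H, i₁, i₂, i₃, π, V, -, hu⟩ := IsCompletelyPositive.exists_dilation.{uA, uK, w} h hS
    exact ⟨H, i₁, i₂, i₃, π, V, hu⟩
  · rintro ⟨H, _, _, _, π, V, hu⟩
    exact isCompletelyPositive_of_dilation hu
  · obtain ⟨H, i₁, i₂, i₃, π, V, hV, hu⟩ := IsCompletelyPositive.exists_dilation.{uA, uK, w} h.1 hS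
    exact ⟨H, i₁, i₂, i₃, π, V,
      hV.trans (Real.sqrt_le_one.mpr (norm_apply_one_le_one h.2 hS.one_mem)), hu⟩
  · rintro ⟨H, _, _, _, π, V, hV, hu⟩
    exact ⟨isCompletelyPositive_of_dilation hu, cbNorm_le_one_of_dilation hV hV hu⟩
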